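/- **Theorem (Cohomology Comparison Theorem for morphisms of differential algebras).** Let $\mathbb F$ be a field of characteristic $0$ and $\lambda\in\mathbb F$. All associative algebras, algebra morphisms and bimodules are unital. A differential algebra of weight $\lambda$ is an associative $\mathbb F$-algebra $A$ with a linear map $d_A:A\to A$ such that $d_A(uv)=d_A(u)v+u\,d_A(v)+\lambda d_A(u)d_A(v)$ and $d_A(1)=0$. A differential bimodule over $(A,d_A)$ is an $A$-bimodule $M$ with a linear map $d_M:M\to M$ such that $d_M(ax)=d_A(a)x+a\,d_M(x)+\lambda d_A(a)d_M(x)$ and $d_M(xa)=x\,d_A(a)+d_M(x)a+\lambda d_M(x)d_A(a)$. Write ${}_\rhd M_\lhd$ for $M$ with the actions $a\rhd m=(a+\lambda d_A(a))m$, $m\lhd a=m(a+\lambda d_A(a))$. For an $A$-bimodule $M$ let $C^n(A,M)=\mathrm{Hom}(A^{\otimes n},M)$ with the Hochschild differential $\partial$, and write $\partial_\rhd$ for the Hochschild differential with coefficients in ${}_\rhd M_\lhd$. For a differential bimodule let $\Phi^n:C^n(A,M)\to C^n(A,{}_\rhd M_\lhd)$ be $$\Phi^n(f)=\sum_{\emptyset\ne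 I\subseteq\{1,\dots,n\}}\lambda^{|I|-1} f\circ d_A^{I}-d_M\circ f ,$$ where $d_A^I$ applies $d_A$ to the tensor factors in the positions in $I$ (so $\Phi^0=-d_M$). All groups in negative degree are $0$. Let $H^n_{\mathrm{DA}_\lambda}(A,M)$ be the cohomology of $C^n_{\mathrm{DA}_\lambda}(A,M)=C^n(A,M)\oplus C^{n-1}(A,{}_\rhd M_\lhd)$ with differential $(f,g)\mapsto(\partial f,\,-\partial_\rhd g-\Phi^n f)$. Let $\phi:(A,d_A)\to(B,d_B)$ be a morphism of differential algebras of weight $\lambda$ (an algebra morphism with $\phi d_A=d_B\phi$) and let $\langle M,N,\psi\rangle$ be a differential $\phi$-bimodule: $M$ is a differential bimodule over $(A,d_A)$, $N$ is one over $(B,d_B)$, and $\psi:M\to N$ is a linear map which commutes with the operators $d_M,d_N$ and is a morphism of $A$-bimodules, $A$ acting on $N$ through $\phi$. Let $C^n(\phi,\psi)=C^n(A,M)\oplus C^n(B,N)\oplus C^{n-1}(A,N)$ with differential $\delta^n(f,g,h)=(\partial f,\partial g,\psi\circ f-g\circ\phi^{\otimes n}-\partial h)$; let $C^\bullet(\phi,{}_\rhd\psi_\lhd)$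 be the same complex for ${}_\rhd M_\lhd$, ${}_\rhd N_\lhd$ and the same map $\psi$, with differential $\delta_\rhd$; and let $\pi^n(f,g,h)=(\Phi^n f,\Phi^n g,\Phi^{n-1}h)$. Let $H^n_{\mathrm{mor}_\lambda}(\phi,\psi)$ be the cohomology of $C^n_{\mathrm{mor}_\lambda}(\phi,\psi)=C^n(\phi,\psi)\oplus C^{n-1}(\phi,{}_\rhd\psi_\lhd)$ with differential $(x,y)\mapsto(\delta^n x,\ \delta_\rhd^{n-1}y+(-1)^n\pi^n x)$. The mapping algebra $\phi!=A\oplus B\oplus B\phi$ has the product $$(a+b_1+b_2\phi)(a'+b_1'+b_2'\phi)=aa'+b_1b_1'+(b_2\phi(a')+b_1b_2')\phi,$$ the unit $1_A+1_B$ and the operator $d_{\phi!}(a+b_1+b_2\phi)=d_A(a)+d_B(b_1)+d_B(b_2)\phi$. Its differential bimodule $\psi!=M\oplus N\oplus N\phi$ has the actions $$(a+b_1+b_2\phi)(m+n_1+n_2\phi)=am+b_1n_1+(b_2\psi(m)+b_1n_2)\phi,$$ $$(m+n_1+n_2\phi)(a+b_1+b_2\phi)=ma+n_1b_1+(n_2\phi(a)+n_1b_2)\phi$$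 and the operator $d_{\psi!}(m+n_1+n_2\phi)=d_M(m)+d_N(n_1)+d_N(n_2)\phi$. Then for every $n\ge 0$ there is an isomorphism of $\mathbb F$-vector spaces $$H^n_{\mathrm{mor}_\lambda}(\phi,\psi)\;\cong\;H^n_{\mathrm{DA}_\lambda}(\phi!,\psi!).$$ -/

import Mathlib

noncomputable section

namespace DiffMor

universe u v w x y

/-! ## Differential algebras and differential bimodules of weight `lam` -/

/-- A differential operator of weight `lam` on a unital associative `F`-algebra `A`. As usual for
unital algebras, the operator is required to kill the unit. -/
structure DiffOp (F : Type u) [Field F] (lam : F) (A : Type v) [Ring A] [Algebra F A] where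
  d : A →ₗ[F] A
  d_mul : ∀ a b : A, d (a * b) = d a * b + a * d b + lam • (d a * d b)
  d_one : d 1 = 0

/-- A (unital) bimodule structure over the associative `F`-algebra `A` on the vector space `M`,
given by its left action `left a m = a m` and its right action `right (op a) m = m a`, which
commute with each other. -/
structure Bimod (F : Type u) [Field F] (A : Type v) [Ring A] [Algebra F A]
    (M : Type w) [AddCommGroup M] [Module F M] where
  left : A →ₐ[F] Module.End F M
  right : Aᵐᵒᵖ →ₐ[F] Module.End F M
  assoc : ∀ (a b : A) (m : M),
    right (MulOpposite.op b) (left a m) = left a (right (MulOpposite.op b) m)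

namespace Bimod

variable {F : Type u} [Field F] {A : Type v} [Ring A] [Algebra F A]
  {B : Type w} [Ring B] [Algebra F B] {M : Type x} [AddCommGroup M] [Module F M]

/-- `S.lact a m` is the product `a m`. -/
def lact (S : Bimod F A M) (a : A) (m : M) : M := S.left a m

/-- `S.ract m a` is the product `m a`. -/
def ract (S : Bimod F A M) (m : M) (a : A) : M := S.right (MulOpposite.op a) m

section Lemmas

variable (S : Bimod F A M)

@[simp] lemma lact_add (a : A) (m m' : M) : S.lact a (m + m') = S.lact a m + S.lact a m' :=
  map_add _ _ _
@[simp] lemma add_lact (a a' : A) (m : M) : S.lact (a + a') m = S.lact a m + S.lact a' m := by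
  simp [lact]
@[simp] lemma lact_smul (c : F) (a : A) (m : M) : S.lact a (c • m) = c • S.lact a m :=
  map_smul _ _ _
@[simp] lemma smul_lact (c : F) (a : A) (m : M) : S.lact (c • a) m = c • S.lact a m := by
  simp [lact]
@[simp] lemma lact_zero (a : A) : S.lact a 0 = 0 := map_zero _
@[simp] lemma zero_lact (m : M) : S.lact 0 m = 0 := by simp [lact]
@[simp] lemma one_lact (m : M) : S.lact 1 m = m := by simp [lact]
lemma mul_lact (a b : A) (m : M) : S.lact (a * b) m = S.lact a (S.lact b m) := by simp [lact]

@[simp] lemma add_ract (a : A) (m m' : M) : S.ract (m + m') a = S.ract m a + S.ract m' a :=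
  map_add _ _ _
@[simp] lemma ract_add (a a' : A) (m : M) : S.ract m (a + a') = S.ract m a + S.ract m a' := by
  simp [ract]
@[simp] lemma smul_ract (c : F) (a : A) (m : M) : S.ract (c • m) a = c • S.ract m a :=
  map_smul _ _ _
@[simp] lemma ract_smul (c : F) (a : A) (m : M) : S.ract m (c • a) = c • S.ract m a := by
  simp [ract]
@[simp] lemma zero_ract (a : A) : S.ract 0 a = 0 := map_zero _
@[simp] lemma ract_zero (m : M) : S.ract m 0 = 0 := by simp [ract]
@[simp] lemma ract_one (m : M) : S.ract m 1 = m := by simp [ract]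
lemma ract_mul (a b : A) (m : M) : S.ract m (a * b) = S.ract (S.ract m a) b := by simp [ract]

lemma ract_lact (a b : A) (m : M) : S.ract (S.lact a m) b = S.lact a (S.ract m b) :=
  S.assoc a b m

end Lemmas

/-- Restriction of a `B`-bimodule along an algebra morphism `A → B`. -/
def restrict (S : Bimod F B M) (σ : A →ₐ[F] B) : Bimod F A M where
  left := S.left.comp σ
  right := S.right.comp (AlgHom.op σ)
  assoc a b m := S.assoc (σ a) (σ b) m

end Bimod

section DiffBimod

variable {F : Type u} [Field F] {lam : F} {A : Type v} [Ring A] [Algebra F A]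
  {B : Type w} [Ring B] [Algebra F B]

/-- A morphism of differential algebras of weight `lam`. -/
structure DiffHom (dA : DiffOp F lam A) (dB : DiffOp F lam B) where
  hom : A →ₐ[F] B
  comm : ∀ a : A, hom (dA.d a) = dB.d (hom a)

/-- A differential bimodule over the differential algebra `(A, dA)` of weight `lam`. -/
structure DiffBimod (dA : DiffOp F lam A) (M : Type x) [AddCommGroup M] [Module F M]
    extends Bimod F A M where
  d : M →ₗ[F] M
  d_lact : ∀ (a : A) (m : M), d (toBimod.lact a m) =
    toBimod.lact (dA.d a) m + toBimod.lact a (d m) + lam • toBimod.lact (dA.d a) (d m)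
  d_ract : ∀ (m : M) (a : A), d (toBimod.ract m a) =
    toBimod.ract m (dA.d a) + toBimod.ract (d m) a + lam • toBimod.ract (d m) (dA.d a)

/-- A differential `B`-bimodule is a differential `A`-bimodule through a morphism `A → B`. -/
def DiffBimod.restrict {dA : DiffOp F lam A} {dB : DiffOp F lam B}
    {M : Type x} [AddCommGroup M] [Module F M]
    (S : DiffBimod dB M) (φ : DiffHom dA dB) : DiffBimod dA M where
  toBimod := S.toBimod.restrict φ.hom
  d := S.d
  d_lact a m := by
    change S.d (S.lact (φ.hom a) m) = S.lact (φ.hom (dA.d a)) m + S.lact (φ.hom a) (S.d m)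
      + lam • S.lact (φ.hom (dA.d a)) (S.d m)
    rw [φ.comm, S.d_lact]
  d_ract m a := by
    change S.d (S.ract m (φ.hom a)) = S.ract m (φ.hom (dA.d a)) + S.ract (S.d m) (φ.hom a)
      + lam • S.ract (S.d m) (φ.hom (dA.d a))
    rw [φ.comm, S.d_ract]

lemma DiffBimod.restrict_lact {dA : DiffOp F lam A} {dB : DiffOp F lam B}
    {M : Type x} [AddCommGroup M] [Module F M]
    (S : DiffBimod dB M) (φ : DiffHom dA dB) (a : A) (m : M) :
    (S.restrict φ).lact a m = S.lact (φ.hom a) m := rfl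

lemma DiffBimod.restrict_ract {dA : DiffOp F lam A} {dB : DiffOp F lam B}
    {M : Type x} [AddCommGroup M] [Module F M]
    (S : DiffBimod dB M) (φ : DiffHom dA dB) (m : M) (a : A) :
    (S.restrict φ).ract m a = S.ract m (φ.hom a) := rfl

/-- The algebra endomorphism `a ↦ a + lam d(a)` of a differential algebra of weight `lam`. -/
def DiffOp.twist (dA : DiffOp F lam A) : A →ₐ[F] A :=
  AlgHom.ofLinearMap (LinearMap.id + lam • dA.d)
    (by simp [dA.d_one])
    (by
      intro a b
      simp only [LinearMap.add_apply, LinearMap.id_apply, LinearMap.smul_apply, dA.d_mul,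
        mul_add, add_mul, smul_add, smul_mul_assoc, mul_smul_comm]
      abel)

/-- The actions `a ▷ m = (a + lam d(a)) m` and `m ◁ a = m (a + lam d(a))`, as a bimodule. -/
def DiffBimod.tri {dA : DiffOp F lam A} {M : Type x} [AddCommGroup M] [Module F M]
    (S : DiffBimod dA M) : Bimod F A M :=
  S.toBimod.restrict dA.twist

/-- A morphism of differential bimodules over `(A, dA)`. -/
structure DiffBimodHom {dA : DiffOp F lam A} {M : Type x} [AddCommGroup M] [Module F M]
    {N : Type y} [AddCommGroup N] [Module F N] (S : DiffBimod dA M) (T : DiffBimod dA N) where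
  hom : M →ₗ[F] N
  map_lact : ∀ (a : A) (m : M), hom (S.lact a m) = T.lact a (hom m)
  map_ract : ∀ (m : M) (a : A), hom (S.ract m a) = T.ract (hom m) a
  comm : ∀ m : M, hom (S.d m) = T.d (hom m)

end DiffBimod

/-! ## Hochschild cochains -/

/-- Hochschild `n`-cochains `Hom(A^{⊗ n}, M)`. -/
abbrev HC (F : Type u) [Field F] (A : Type v) [Ring A] [Algebra F A]
    (M : Type w) [AddCommGroup M] [Module F M] (n : ℕ) : Type (max v w) :=
  MultilinearMap F (fun _ : Fin n => A) M

section Hochschild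

variable {F : Type u} [Field F] {A : Type v} [Ring A] [Algebra F A]
  {B : Type x} [Ring B] [Algebra F B]
  {M : Type w} [AddCommGroup M] [Module F M]

/-- The position of the contracted tuple that depends on the `i`-th entry. -/
lemma contractNth_update {n : ℕ} (j : Fin n) (i : Fin (n + 1)) :
    ∃ p : Fin n, ∀ a : Fin (n + 1) → A, ∃ w : A →ₗ[F] A, ∀ v : A,
      Fin.contractNth j.castSucc (· * ·) (Function.update a i v) =
        Function.update (Fin.contractNth j.castSucc (· * ·) a) p (w v) := by
  classical
  rcases lt_trichotomy i.val j.val with h | h | h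
  · refine ⟨⟨i.val, by omega⟩, fun a => ⟨LinearMap.id, fun v => funext fun k => ?_⟩⟩
    simp only [Fin.contractNth, Function.update_apply, Fin.ext_iff, Fin.val_castSucc,
      Fin.val_succ, LinearMap.id_apply]
    split_ifs <;> first | rfl | omega
  · refine ⟨⟨i.val, by omega⟩, fun a =>
      ⟨LinearMap.mulRight F (a j.succ), fun v => funext fun k => ?_⟩⟩
    simp only [Fin.contractNth, Function.update_apply, Fin.ext_iff, Fin.val_castSucc,
      Fin.val_succ, LinearMap.mulRight_apply]
    split_ifs <;> first | rfl | omega | skip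
    have : k = j := Fin.ext (by assumption)
    rw [this]
  · by_cases h' : i.val = j.val + 1
    · refine ⟨j, fun a =>
        ⟨LinearMap.mulLeft F (a j.castSucc), fun v => funext fun k => ?_⟩⟩
      simp only [Fin.contractNth, Function.update_apply, Fin.ext_iff, Fin.val_castSucc,
        Fin.val_succ, LinearMap.mulLeft_apply]
      split_ifs <;> first | rfl | omega | skip
      have : k = j := Fin.ext (by assumption)
      rw [this]
    · refine ⟨⟨i.val - 1, by omega⟩, fun a => ⟨LinearMap.id, fun v => funext fun k => ?_⟩⟩
      simp only [Fin.contractNth, Function.update_apply, Fin.ext_iff, Fin.val_castSucc,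
        Fin.val_succ, LinearMap.id_apply]
      split_ifs <;> first | rfl | omega

/-- The cochain `a_1 ⊗ ⋯ ⊗ a_{n+1} ↦ f(a_1 ⊗ ⋯ ⊗ a_j a_{j+1} ⊗ ⋯ ⊗ a_{n+1})` (`j` counted from
zero in the code). -/
def contractCochain {n : ℕ} (f : HC F A M n) (j : Fin n) : HC F A M (n + 1) where
  toFun a := f (Fin.contractNth j.castSucc (· * ·) a)
  map_update_add' {inst} a i v v' := by
    obtain rfl : inst = instDecidableEqFin _ := Subsingleton.elim _ _
    obtain ⟨p, hp⟩ := contractNth_update (F := F) (A := A) j i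
    obtain ⟨w, hw⟩ := hp a
    simp only [hw, map_add, f.map_update_add]
  map_update_smul' {inst} a i c v := by
    obtain rfl : inst = instDecidableEqFin _ := Subsingleton.elim _ _
    obtain ⟨p, hp⟩ := contractNth_update (F := F) (A := A) j i
    obtain ⟨w, hw⟩ := hp a
    simp only [hw, map_smul, f.map_update_smul]

/-- The cochain `a_1 ⊗ ⋯ ⊗ a_{n+1} ↦ a_1 f(a_2 ⊗ ⋯ ⊗ a_{n+1})`. -/
def firstCochain (S : Bimod F A M) {n : ℕ} (f : HC F A M n) : HC F A M (n + 1) where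
  toFun a := S.lact (a 0) (f (Fin.tail a))
  map_update_add' {inst} a i v v' := by
    obtain rfl : inst = instDecidableEqFin _ := Subsingleton.elim _ _
    refine Fin.cases ?_ (fun i => ?_) i
    · simp [Bimod.lact, Fin.tail_update_zero]
    · have h : ∀ v : A, Function.update a i.succ v 0 = a 0 := fun v =>
        Function.update_of_ne (Fin.succ_ne_zero i).symm v a
      simp [Bimod.lact, Fin.tail_update_succ, h]
  map_update_smul' {inst} a i c v := by
    obtain rfl : inst = instDecidableEqFin _ := Subsingleton.elim _ _
    refine Fin.cases ?_ (fun i => ?_) i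
    · simp [Bimod.lact, Fin.tail_update_zero]
    · have h : ∀ v : A, Function.update a i.succ v 0 = a 0 := fun v =>
        Function.update_of_ne (Fin.succ_ne_zero i).symm v a
      simp [Bimod.lact, Fin.tail_update_succ, h]

/-- The cochain `a_1 ⊗ ⋯ ⊗ a_{n+1} ↦ f(a_1 ⊗ ⋯ ⊗ a_n) a_{n+1}`. -/
def lastCochain (S : Bimod F A M) {n : ℕ} (f : HC F A M n) : HC F A M (n + 1) where
  toFun a := S.ract (f (Fin.init a)) (a (Fin.last n))
  map_update_add' {inst} a i v v' := by
    obtain rfl : inst = instDecidableEqFin _ := Subsingleton.elim _ _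
    refine Fin.lastCases ?_ (fun i => ?_) i
    · simp [Bimod.ract, Fin.init_update_last]
    · simp [Bimod.ract, Fin.init_update_castSucc, (Fin.castSucc_lt_last i).ne']
  map_update_smul' {inst} a i c v := by
    obtain rfl : inst = instDecidableEqFin _ := Subsingleton.elim _ _
    refine Fin.lastCases ?_ (fun i => ?_) i
    · simp [Bimod.ract, Fin.init_update_last]
    · simp [Bimod.ract, Fin.init_update_castSucc, (Fin.castSucc_lt_last i).ne']

/-- The Hochschild differential `C^n(A, M) → C^{n+1}(A, M)`. -/
def dAlg (S : Bimod F A M) (n : ℕ) : HC F A M n →ₗ[F] HC F A M (n + 1) where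
  toFun f := firstCochain S f + ∑ j : Fin n, (-1 : F) ^ (j.val + 1) • contractCochain f j
    + (-1 : F) ^ (n + 1) • lastCochain S f
  map_add' f g := by
    ext a
    simp only [add_apply, sum_apply, smul_apply,
      firstCochain, contractCochain, lastCochain, MultilinearMap.coe_mk, Bimod.lact, Bimod.ract,
      map_add, smul_add, Finset.sum_add_distrib]
    abel
  map_smul' c f := by
    ext a
    simp only [add_apply, sum_apply, smul_apply,
      firstCochain, contractCochain, lastCochain, MultilinearMap.coe_mk, Bimod.lact, Bimod.ract,
      map_smul, smul_add, Finset.smul_sum, smul_comm _ c, RingHom.id_apply]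

lemma dAlg_apply (S : Bimod F A M) (n : ℕ) (f : HC F A M n) (a : Fin (n + 1) → A) :
    dAlg S n f a = S.lact (a 0) (f (Fin.tail a))
      + ∑ j : Fin n, (-1 : F) ^ (j.val + 1) • f (Fin.contractNth j.castSucc (· * ·) a)
      + (-1 : F) ^ (n + 1) • S.ract (f (Fin.init a)) (a (Fin.last n)) := by
  simp [dAlg, firstCochain, contractCochain, lastCochain]

/-- Postcomposition `f ↦ ψ ∘ f` of cochains with a linear map. -/
def postComp {N : Type y} [AddCommGroup N] [Module F N] (ψ : M →ₗ[F] N) (n : ℕ) :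
    HC F A M n →ₗ[F] HC F A N n :=
  ψ.compMultilinearMapₗ F

/-- Precomposition `g ↦ g ∘ φ^{⊗ n}` of cochains with an algebra morphism. -/
def preComp (φ : A →ₐ[F] B) (n : ℕ) : HC F B M n →ₗ[F] HC F A M n :=
  MultilinearMap.compLinearMapₗ (fun _ : Fin n => φ.toLinearMap)

variable {lam : F} {dA : DiffOp F lam A}

/-- The map `Φ^n`: the sum, over the nonempty sets `s` of positions, of `lam ^ (|s| - 1)` times
`f` with `d_A` applied to the arguments at the positions in `s`, minus `d_M ∘ f`.
In degree zero this is `-d_M`. -/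
def bigPhi (S : DiffBimod dA M) (n : ℕ) : HC F A M n →ₗ[F] HC F A M n :=
  ∑ s : Finset (Fin n) with s.Nonempty,
      lam ^ (s.card - 1) • MultilinearMap.compLinearMapₗ
        (fun i : Fin n => if i ∈ s then dA.d else LinearMap.id)
    - postComp S.d n

end Hochschild

/-! ## Cohomology of a sequence of linear maps, and shifted graded spaces -/

/-- The shift of a graded vector space: `X^{n-1}` in degree `n`, and `0` in degree `0`. -/
def Shift (X : ℕ → Type u) : ℕ → Type u
  | 0 => PUnit
  | n + 1 => X n

section Shift

variable {F : Type v} [Field F]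

instance (X : ℕ → Type u) [∀ n, AddCommGroup (X n)] : ∀ n, AddCommGroup (Shift X n)
  | 0 => inferInstanceAs (AddCommGroup PUnit.{u + 1})
  | n + 1 => inferInstanceAs (AddCommGroup (X n))

instance (X : ℕ → Type u) [∀ n, AddCommGroup (X n)] [∀ n, Module F (X n)] :
    ∀ n, Module F (Shift X n)
  | 0 => by exact (inferInstance : Module F PUnit.{u + 1})
  | n + 1 => by exact (inferInstance : Module F (X n))

/-- A map of degree one, from the shift: `d^{n-1} : X^{n-1} → X^n`. -/
def shiftD {X : ℕ → Type u} [∀ n, AddCommGroup (X n)] [∀ n, Module F (X n)]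
    (d : ∀ n, X n →ₗ[F] X (n + 1)) : ∀ n, Shift X n →ₗ[F] X n
  | 0 => 0
  | n + 1 => d n

/-- A map of degree zero, between the shifts: `f^{n-1} : X^{n-1} → Y^{n-1}`. -/
def shiftMap {X : ℕ → Type u} [∀ n, AddCommGroup (X n)] [∀ n, Module F (X n)]
    {Y : ℕ → Type w} [∀ n, AddCommGroup (Y n)] [∀ n, Module F (Y n)]
    (f : ∀ n, X n →ₗ[F] Y n) : ∀ n, Shift X n →ₗ[F] Shift Y n
  | 0 => 0
  | n + 1 => f n

/-- The cohomology `ker d^n / im d^{n-1}` of a cochain complex (with `im d^{-1} = 0`). -/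
abbrev Cohomology {X : ℕ → Type u} [∀ n, AddCommGroup (X n)] [∀ n, Module F (X n)]
    (d : ∀ n, X n →ₗ[F] X (n + 1)) (n : ℕ) : Type u :=
  LinearMap.ker (d n) ⧸ (LinearMap.range (shiftD d n)).submoduleOf (LinearMap.ker (d n))

end Shift

/-! ## Cohomology of a differential algebra -/

section DA

variable {F : Type u} [Field F] {lam : F} {A : Type v} [Ring A] [Algebra F A]
  {dA : DiffOp F lam A} {M : Type w} [AddCommGroup M] [Module F M]

/-- `C_DA^n(A, M) = C^n(A, M) ⊕ C^{n-1}(A, ▷M◁)`, and `C_DA^0(A, M) = C^0(A, M)`. -/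
abbrev CDA (F : Type u) [Field F] (A : Type v) [Ring A] [Algebra F A]
    (M : Type w) [AddCommGroup M] [Module F M] (n : ℕ) : Type (max v w) :=
  HC F A M n × Shift (HC F A M) n

/-- The differential `(f, g) ↦ (∂ f, - ∂_▷ g - Φ f)` of `C_DA(A, M)`. -/
def dDA (S : DiffBimod dA M) (n : ℕ) : CDA F A M n →ₗ[F] CDA F A M (n + 1) :=
  LinearMap.prod
    (dAlg S.toBimod n ∘ₗ LinearMap.fst F _ _)
    (-(shiftD (dAlg S.tri) n ∘ₗ LinearMap.snd F _ _) - bigPhi S n ∘ₗ LinearMap.fst F _ _)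

/-- The cohomology `H_DA^n(A, M)` of a differential algebra with coefficients in a differential
bimodule. -/
abbrev HDA (S : DiffBimod dA M) (n : ℕ) : Type (max v w) :=
  Cohomology (dDA S) n

end DA

/-! ## Cohomology of a morphism of differential algebras -/

section Mor

variable {F : Type u} [Field F] {lam : F} {A : Type v} [Ring A] [Algebra F A]
  {B : Type w} [Ring B] [Algebra F B] {dA : DiffOp F lam A} {dB : DiffOp F lam B}
  {M : Type x} [AddCommGroup M] [Module F M] {N : Type y} [AddCommGroup N] [Module F N]

/-- `C^n(φ, ψ) = C^n(A, M) ⊕ C^n(B, N) ⊕ C^{n-1}(A, N)`, the last summand being `0` for `n = 0`. -/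
abbrev CPhi (F : Type u) [Field F] (A : Type v) [Ring A] [Algebra F A]
    (B : Type w) [Ring B] [Algebra F B] (M : Type x) [AddCommGroup M] [Module F M]
    (N : Type y) [AddCommGroup N] [Module F N] (n : ℕ) : Type (max v w x y) :=
  HC F A M n × HC F B N n × Shift (HC F A N) n

/-- The differential `(f, g, h) ↦ (∂ f, ∂ g, ψ ∘ f - g ∘ φ^{⊗ n} - ∂ h)` of the complex of an
algebra morphism `φ`, for an `A`-bimodule `M`, a `B`-bimodule `N` and `ψ : M → N`. -/
def dPhi (φ : A →ₐ[F] B) (S : Bimod F A M) (T : Bimod F B N) (ψ : M →ₗ[F] N) (n : ℕ) :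
    CPhi F A B M N n →ₗ[F] CPhi F A B M N (n + 1) :=
  LinearMap.prod
    (dAlg S n ∘ₗ LinearMap.fst F _ _)
    (LinearMap.prod
      (dAlg T n ∘ₗ LinearMap.fst F _ _ ∘ₗ LinearMap.snd F _ _)
      (postComp ψ n ∘ₗ LinearMap.fst F _ _
        - preComp φ n ∘ₗ LinearMap.fst F _ _ ∘ₗ LinearMap.snd F _ _
        - shiftD (dAlg (T.restrict φ)) n ∘ₗ LinearMap.snd F _ _ ∘ₗ LinearMap.snd F _ _))

/-- The map `π^n = (Φ^n, Φ^n, Φ^{n-1})` from `C^n(φ, ψ)` to `C^n(φ, ▷ψ◁)`. -/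
def piMap (φ : DiffHom dA dB) (S : DiffBimod dA M) (T : DiffBimod dB N) (n : ℕ) :
    CPhi F A B M N n →ₗ[F] CPhi F A B M N n :=
  LinearMap.prodMap (bigPhi S n)
    (LinearMap.prodMap (bigPhi T n) (shiftMap (bigPhi (T.restrict φ)) n))

/-- `C_mor^n(φ, ψ) = C^n(φ, ψ) ⊕ C^{n-1}(φ, ▷ψ◁)`, and `C_mor^0(φ, ψ) = C^0(φ, ψ)`. -/
abbrev CMor (F : Type u) [Field F] (A : Type v) [Ring A] [Algebra F A]
    (B : Type w) [Ring B] [Algebra F B] (M : Type x) [AddCommGroup M] [Module F M]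
    (N : Type y) [AddCommGroup N] [Module F N] (n : ℕ) : Type (max v w x y) :=
  CPhi F A B M N n × Shift (CPhi F A B M N) n

/-- The differential `(x, y) ↦ (δ^n x, δ_▷^{n-1} y + (-1)^n π^n x)` of `C_mor(φ, ψ)`. -/
def dMor (φ : DiffHom dA dB) {S : DiffBimod dA M} {T : DiffBimod dB N}
    (ψ : DiffBimodHom S (T.restrict φ)) (n : ℕ) :
    CMor F A B M N n →ₗ[F] CMor F A B M N (n + 1) :=
  LinearMap.prod
    (dPhi φ.hom S.toBimod T.toBimod ψ.hom n ∘ₗ LinearMap.fst F _ _)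
    (shiftD (dPhi φ.hom S.tri T.tri ψ.hom) n ∘ₗ LinearMap.snd F _ _
      + (-1 : F) ^ n • (piMap φ S T n ∘ₗ LinearMap.fst F _ _))

/-- The cohomology `H_mor^n(φ, ψ)` of a morphism `φ` of differential algebras with coefficients
in a differential `φ`-bimodule `⟨M, N, ψ⟩`. -/
abbrev HMor (φ : DiffHom dA dB) {S : DiffBimod dA M} {T : DiffBimod dB N}
    (ψ : DiffBimodHom S (T.restrict φ)) (n : ℕ) : Type (max v w x y) :=
  Cohomology (dMor φ ψ) n

end Mor

/-! ## The mapping algebra and its bimodule -/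

section MapAlg

variable {F : Type u} [Field F] {lam : F} {A : Type v} [Ring A] [Algebra F A]
  {B : Type w} [Ring B] [Algebra F B]

/-- The mapping algebra `φ! = A ⊕ B ⊕ Bφ`; the triple `(a, b₁, b₂)` stands for `a + b₁ + b₂φ`. -/
def MapAlg (_φ : A →ₐ[F] B) : Type (max v w) := A × B × B

namespace MapAlg

variable (φ : A →ₐ[F] B)

instance : AddCommGroup (MapAlg φ) := inferInstanceAs (AddCommGroup (A × B × B))

instance : Module F (MapAlg φ) := inferInstanceAs (Module F (A × B × B))

/-- The element `a + b₁ + b₂φ`. -/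
def mk (a : A) (b₁ b₂ : B) : MapAlg φ := (a, b₁, b₂)

instance : Mul (MapAlg φ) :=
  ⟨fun x y => mk φ (x.1 * y.1) (x.2.1 * y.2.1) (x.2.2 * φ y.1 + x.2.1 * y.2.2)⟩

instance : One (MapAlg φ) := ⟨mk φ 1 1 0⟩

variable {φ}

@[ext] lemma ext {x y : MapAlg φ} (h₁ : x.1 = y.1) (h₂ : x.2.1 = y.2.1) (h₃ : x.2.2 = y.2.2) :
    x = y :=
  Prod.ext h₁ (Prod.ext h₂ h₃)

@[simp] lemma mk_fst (a : A) (b₁ b₂ : B) : (mk φ a b₁ b₂).1 = a := rfl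
@[simp] lemma mk_snd (a : A) (b₁ b₂ : B) : (mk φ a b₁ b₂).2.1 = b₁ := rfl
@[simp] lemma mk_trd (a : A) (b₁ b₂ : B) : (mk φ a b₁ b₂).2.2 = b₂ := rfl
@[simp] lemma mul_fst (x y : MapAlg φ) : (x * y).1 = x.1 * y.1 := rfl
@[simp] lemma mul_snd (x y : MapAlg φ) : (x * y).2.1 = x.2.1 * y.2.1 := rfl
@[simp] lemma mul_trd (x y : MapAlg φ) :
    (x * y).2.2 = x.2.2 * φ y.1 + x.2.1 * y.2.2 := rfl
@[simp] lemma one_fst : (1 : MapAlg φ).1 = 1 := rfl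
@[simp] lemma one_snd : (1 : MapAlg φ).2.1 = 1 := rfl
@[simp] lemma one_trd : (1 : MapAlg φ).2.2 = 0 := rfl
@[simp] lemma zero_fst : (0 : MapAlg φ).1 = 0 := rfl
@[simp] lemma zero_snd : (0 : MapAlg φ).2.1 = 0 := rfl
@[simp] lemma zero_trd : (0 : MapAlg φ).2.2 = 0 := rfl
@[simp] lemma add_fst (x y : MapAlg φ) : (x + y).1 = x.1 + y.1 := rfl
@[simp] lemma add_snd (x y : MapAlg φ) : (x + y).2.1 = x.2.1 + y.2.1 := rfl
@[simp] lemma add_trd (x y : MapAlg φ) : (x + y).2.2 = x.2.2 + y.2.2 := rfl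
@[simp] lemma smul_fst (c : F) (x : MapAlg φ) : (c • x).1 = c • x.1 := rfl
@[simp] lemma smul_snd (c : F) (x : MapAlg φ) : (c • x).2.1 = c • x.2.1 := rfl
@[simp] lemma smul_trd (c : F) (x : MapAlg φ) : (c • x).2.2 = c • x.2.2 := rfl

variable (φ)

instance : Ring (MapAlg φ) :=
  { (inferInstance : AddCommGroup (MapAlg φ)), (inferInstance : Mul (MapAlg φ)),
    (inferInstance : One (MapAlg φ)) with
    left_distrib := fun x y z => by ext <;> simp [mul_add]; abel
    right_distrib := fun x y z => by ext <;> simp [add_mul]; abel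
    zero_mul := fun x => by ext <;> simp
    mul_zero := fun x => by ext <;> simp
    mul_assoc := fun x y z => by ext <;> simp [mul_assoc, mul_add, add_mul, add_assoc]
    one_mul := fun x => by ext <;> simp
    mul_one := fun x => by ext <;> simp }

instance : Algebra F (MapAlg φ) :=
  Algebra.ofModule (fun c x y => by ext <;> simp) (fun c x y => by ext <;> simp)

end MapAlg

variable {dA : DiffOp F lam A} {dB : DiffOp F lam B}

/-- The differential operator `a + b₁ + b₂φ ↦ d_A(a) + d_B(b₁) + d_B(b₂)φ` on `φ!`. -/
def mapAlgDiff (φ : DiffHom dA dB) : DiffOp F lam (MapAlg φ.hom) where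
  d :=
    { toFun := fun x => MapAlg.mk φ.hom (dA.d x.1) (dB.d x.2.1) (dB.d x.2.2)
      map_add' := fun x y => by ext <;> simp
      map_smul' := fun c x => by ext <;> simp }
  d_mul x y := by
    ext
    · simp [dA.d_mul]
    · simp [dB.d_mul]
    · simp [dB.d_mul, φ.comm]
      abel
  d_one := by
    ext <;> simp [dA.d_one, dB.d_one]

variable {M : Type x} [AddCommGroup M] [Module F M] {N : Type y} [AddCommGroup N] [Module F N]

/-- The `φ!`-bimodule `ψ! = M ⊕ N ⊕ Nφ`; the triple `(m, n₁, n₂)` stands for `m + n₁ + n₂φ`. -/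
def mapBimod (φ : DiffHom dA dB) {S : DiffBimod dA M} {T : DiffBimod dB N}
    (ψ : DiffBimodHom S (T.restrict φ)) : Bimod F (MapAlg φ.hom) (M × N × N) where
  left := AlgHom.ofLinearMap
    { toFun := fun x =>
        { toFun := fun m => (S.lact x.1 m.1, T.lact x.2.1 m.2.1,
            T.lact x.2.2 (ψ.hom m.1) + T.lact x.2.1 m.2.2)
          map_add' := fun m m' => by ext <;> simp; abel
          map_smul' := fun c m => by ext <;> simp }
      map_add' := fun x x' => by ext m <;> simp
      map_smul' := fun c x => by ext m <;> simp }
    (by ext m <;> simp)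
    (by
      intro x y
      ext m <;> simp [Bimod.mul_lact, ψ.map_lact, DiffBimod.restrict_lact])
  right := AlgHom.ofLinearMap
    { toFun := fun x =>
        { toFun := fun m => (S.ract m.1 x.unop.1, T.ract m.2.1 x.unop.2.1,
            T.ract m.2.2 (φ.hom x.unop.1) + T.ract m.2.1 x.unop.2.2)
          map_add' := fun m m' => by ext <;> simp; abel
          map_smul' := fun c m => by ext <;> simp }
      map_add' := fun x x' => by ext m <;> simp
      map_smul' := fun c x => by ext m <;> simp }
    (by ext m <;> simp)
    (by intro x y; ext m <;> simp [Bimod.ract_mul])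
  assoc x y m := by
    ext
    · simp [Bimod.ract_lact]
    · simp [Bimod.ract_lact]
    · simp [Bimod.ract_lact, ψ.map_ract, DiffBimod.restrict_ract]
      abel

section

variable (φ : DiffHom dA dB) {S : DiffBimod dA M} {T : DiffBimod dB N}
  (ψ : DiffBimodHom S (T.restrict φ))

lemma mapBimod_lact (x : MapAlg φ.hom) (m : M × N × N) : (mapBimod φ ψ).lact x m =
    (S.lact x.1 m.1, T.lact x.2.1 m.2.1, T.lact x.2.2 (ψ.hom m.1) + T.lact x.2.1 m.2.2) := rfl

lemma mapBimod_ract (m : M × N × N) (x : MapAlg φ.hom) : (mapBimod φ ψ).ract m x =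
    (S.ract m.1 x.1, T.ract m.2.1 x.2.1, T.ract m.2.2 (φ.hom x.1) + T.ract m.2.1 x.2.2) := rfl

lemma mapAlgDiff_d (x : MapAlg φ.hom) : (mapAlgDiff φ).d x =
    MapAlg.mk φ.hom (dA.d x.1) (dB.d x.2.1) (dB.d x.2.2) := rfl

end

/-- The differential `φ!`-bimodule `ψ!`, with `m + n₁ + n₂φ ↦ d_M(m) + d_N(n₁) + d_N(n₂)φ`. -/
def mapDiffBimod (φ : DiffHom dA dB) {S : DiffBimod dA M} {T : DiffBimod dB N}
    (ψ : DiffBimodHom S (T.restrict φ)) : DiffBimod (mapAlgDiff φ) (M × N × N) where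
  toBimod := mapBimod φ ψ
  d := LinearMap.prodMap S.d (LinearMap.prodMap T.d T.d)
  d_lact x m := by
    have h : ψ.hom (S.d m.1) = T.d (ψ.hom m.1) := ψ.comm m.1
    ext
    · simp [mapBimod_lact, mapAlgDiff_d, S.d_lact]
    · simp [mapBimod_lact, mapAlgDiff_d, T.d_lact]
    · simp [mapBimod_lact, mapAlgDiff_d, T.d_lact, h]
      abel
  d_ract m x := by
    ext
    · simp [mapBimod_ract, mapAlgDiff_d, S.d_ract]
    · simp [mapBimod_ract, mapAlgDiff_d, T.d_ract]
    · simp [mapBimod_ract, mapAlgDiff_d, T.d_ract, φ.comm]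
      abel

end MapAlg

end DiffMor

end

/-! The restriction map from the Hochschild complex of `φ!` with coefficients in `ψ!` to C(φ, ψ) is
a surjective quasi-isomorphism compatible with Φ, hence induces one between the two mapping-cone
complexes.

Write a cochain as f = (f_M, f_N, f_φ) along M ⊕ N ⊕ Nφ. The map `comparison` restricts f_M to A and
f_N to B, and sends f_φ to the alternating sum of the f_φ(φ(a_1), …, φ(a_i), φ, a_{i+1}, …) with
sign (-1)^i. In `φ!` one has φ·a = φ(a)·φ, so the faces adjacent to the inserted φ cancel in pairs.
The two outer terms that survive are ψ ∘ f_M and f_N ∘ φ^{⊗n}, which is why `comparison_dAlg` holds.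
Surjectivity comes from the projections of `φ!` and from the cup product with the derivation D(a +
b₁ + b₂φ) = b₂.

The core is the acyclicity of the kernel, `exists_primitive_ker_comparison`. All homotopies are
insertions of a column e with e·θ(x) = Θ(x)·e, covered by `insertion_hoch_succ`. Inserting 1_A or
1_B gives primitives for f_M and f_N. For the corner Nφ, the identity 1_B·x = b₁·1_B + b₂·φ forces
the insertion of φ and 1_B together. It shows that a corner cocycle f is cohomologous to the cup
product D ∪ h(f), where h inserts φ (`cornerInsertion_true_hoch`). Now h(f) is itself a cocycle with
coefficients in an A-bimodule, and its restriction to A vanishes on the kernel, so it is exact and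
so is f.

Finally Φ commutes with the comparison (`comparison_bigPhi`), because the operator of `φ!` preserves
the three summands and kills the element φ. With the sign (-1)^n on the second summand the
comparison extends to the full complexes. Its kernel there is again acyclic, and
`nonempty_cohomology_equiv` concludes. -/

noncomputable section

namespace DiffMor

universe u v w x y

/-! ### Cochains through their first argument, and a recursive Hochschild differential. -/

section Slices

variable {F : Type u} [Field F] {A : Type v} [Ring A] [Algebra F A]
  {B : Type w} [Ring B] [Algebra F B] {M : Type x} [AddCommGroup M] [Module F M]
  {N : Type y} [AddCommGroup N] [Module F N]

/-- Fixing the first argument of a cochain. -/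
def slice (n : ℕ) : HC F A M (n + 1) ≃ₗ[F] (A →ₗ[F] HC F A M n) :=
  multilinearCurryLeftEquiv F (fun _ : Fin (n + 1) => A) M

lemma slice_apply {n : ℕ} (f : HC F A M (n + 1)) (a : A) (v : Fin n → A) :
    slice n f a v = f (Fin.cons a v) := rfl

lemma apply_eq_slice {n : ℕ} (f : HC F A M (n + 1)) (v : Fin (n + 1) → A) :
    f v = slice n f (v 0) (Fin.tail v) := by
  rw [slice_apply, Fin.cons_self_tail]

lemma slice_ext {n : ℕ} {f g : HC F A M (n + 1)} (h : ∀ a, slice n f a = slice n g a) : f = g :=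
  (slice n).injective (LinearMap.ext h)

/-- Precomposition of cochains with a linear map in every argument. -/
def pull (θ : A →ₗ[F] B) (n : ℕ) : HC F B M n →ₗ[F] HC F A M n :=
  MultilinearMap.compLinearMapₗ (fun _ : Fin n => θ)

lemma pull_apply (θ : A →ₗ[F] B) (n : ℕ) (f : HC F B M n) (v : Fin n → A) :
    pull θ n f v = f fun i => θ (v i) := rfl

@[simp] lemma slice_pull (θ : A →ₗ[F] B) (n : ℕ) (f : HC F B M (n + 1)) (a : A) :
    slice n (pull θ (n + 1) f) a = pull θ n (slice n f (θ a)) := by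
  ext v
  simp only [slice_apply, pull_apply]
  congr 1
  funext i
  refine Fin.cases ?_ (fun i => ?_) i <;> simp

lemma postComp_apply (g : M →ₗ[F] N) (n : ℕ) (f : HC F A M n) (v : Fin n → A) :
    postComp g n f v = g (f v) := rfl

@[simp] lemma slice_postComp (g : M →ₗ[F] N) (n : ℕ) (f : HC F A M (n + 1)) (a : A) :
    slice n (postComp g (n + 1) f) a = postComp g n (slice n f a) := rfl

lemma pull_postComp (θ : A →ₗ[F] B) (g : M →ₗ[F] N) (n : ℕ) (f : HC F B M n) :
    pull θ n (postComp g n f) = postComp g n (pull θ n f) := rfl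

lemma postComp_add (g g' : M →ₗ[F] N) (n : ℕ) (f : HC F A M n) :
    postComp (g + g') n f = postComp g n f + postComp g' n f := rfl

lemma postComp_smul (c : F) (g : M →ₗ[F] N) (n : ℕ) (f : HC F A M n) :
    postComp (c • g) n f = c • postComp g n f := rfl

lemma postComp_zero (n : ℕ) (f : HC F A M n) : postComp (0 : M →ₗ[F] N) n f = 0 := rfl

lemma postComp_id (n : ℕ) (f : HC F A M n) : postComp LinearMap.id n f = f := rfl

lemma postComp_postComp {K : Type*} [AddCommGroup K] [Module F K] (h : N →ₗ[F] K) (g : M →ₗ[F] N)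
    (n : ℕ) (f : HC F A M n) :
    postComp h n (postComp g n f) = postComp (h ∘ₗ g) n f := rfl

lemma pull_pull {C : Type*} [Ring C] [Algebra F C] (θ : A →ₗ[F] B) (η : B →ₗ[F] C) (n : ℕ)
    (f : HC F C M n) : pull θ n (pull η n f) = pull (η ∘ₗ θ) n f := rfl

lemma pull_id (n : ℕ) (f : HC F A M n) : pull LinearMap.id n f = f := rfl

/-- In degree zero, precomposition does not depend on the map. -/
lemma pull_zero_congr (θ η : A →ₗ[F] B) (f : HC F B M 0) : pull θ 0 f = pull η 0 f := by
  ext v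
  simp only [pull_apply]
  congr 1
  exact Subsingleton.elim _ _

/-- The cochain `a_1 ⊗ ⋯ ⊗ a_{n+1} ↦ l(a_1) f(a_2 ⊗ ⋯ ⊗ a_{n+1})`. -/
def leading (l : A →ₗ[F] M →ₗ[F] N) (n : ℕ) : HC F A M n →ₗ[F] HC F A N (n + 1) :=
  (slice n).symm.toLinearMap ∘ₗ LinearMap.mk₂ F (fun f a => postComp (l a) n f)
    (fun f g a => map_add _ f g) (fun c f a => map_smul _ c f)
    (fun f a b => by rw [map_add, postComp_add]) (fun c f a => by rw [map_smul, postComp_smul])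

@[simp] lemma slice_leading (l : A →ₗ[F] M →ₗ[F] N) (n : ℕ) (f : HC F A M n) (a : A) :
    slice n (leading l n f) a = postComp (l a) n f := by
  simp [leading]

/-- Multiplication of the first argument by `a` on the left. -/
def absorb (n : ℕ) (f : HC F A M (n + 1)) : A →ₗ[F] HC F A M (n + 1) :=
  (slice n).symm.toLinearMap ∘ₗ LinearMap.mk₂ F (fun a b => slice n f (a * b))
    (fun a a' b => by rw [add_mul, map_add])
    (fun c a b => by rw [smul_mul_assoc, map_smul])
    (fun a b b' => by rw [mul_add, map_add])
    (fun c a b => by rw [mul_smul_comm, map_smul])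

@[simp] lemma slice_absorb (n : ℕ) (f : HC F A M (n + 1)) (a b : A) :
    slice n (absorb n f a) b = slice n f (a * b) := by
  simp [absorb]

lemma absorb_add (n : ℕ) (f g : HC F A M (n + 1)) : absorb n (f + g) = absorb n f + absorb n g := by
  refine LinearMap.ext fun a => slice_ext fun b => ?_
  simp

lemma absorb_smul (n : ℕ) (c : F) (f : HC F A M (n + 1)) :
    absorb n (c • f) = c • absorb n f := by
  refine LinearMap.ext fun a => slice_ext fun b => ?_
  simp

lemma absorb_postComp (g : M →ₗ[F] N) (n : ℕ) (f : HC F A M (n + 1)) (a : A) :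
    absorb n (postComp g (n + 1) f) a = postComp g (n + 1) (absorb n f a) := by
  refine slice_ext fun b => ?_
  simp

/-- The Hochschild differential without its first term, for a right action `r`. -/
def trailing (r : A →ₗ[F] Module.End F M) : ∀ n, HC F A M n →ₗ[F] HC F A M (n + 1)
  -- In degree zero the only term left is the right multiplication, with sign (-1)^{0+1}.
  | 0 => -leading r 0
  | n + 1 => (slice (n + 1)).symm.toLinearMap ∘ₗ
      LinearMap.mk₂ F (fun f a => -absorb n f a - trailing r n (slice n f a))
        (fun f g a => by simp only [absorb_add, map_add, LinearMap.add_apply]; abel)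
        (fun c f a => by simp only [absorb_smul, map_smul, LinearMap.smul_apply, smul_sub, smul_neg])
        (fun f a b => by simp only [map_add]; abel)
        (fun c f a => by simp only [map_smul, smul_sub, smul_neg])

@[simp] lemma slice_trailing_zero (r : A →ₗ[F] Module.End F M) (f : HC F A M 0) (a : A) :
    slice 0 (trailing r 0 f) a = -postComp (r a) 0 f := by
  simp [trailing]

@[simp] lemma slice_trailing_succ (r : A →ₗ[F] Module.End F M) (n : ℕ) (f : HC F A M (n + 1))
    (a : A) :
    slice (n + 1) (trailing r (n + 1) f) a = -absorb n f a - trailing r n (slice n f a) := by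
  simp [trailing]

/-- The Hochschild differential for a left action `l` and a right action `r`. -/
def hoch (l r : A →ₗ[F] Module.End F M) (n : ℕ) : HC F A M n →ₗ[F] HC F A M (n + 1) :=
  leading l n + trailing r n

lemma hoch_apply (l r : A →ₗ[F] Module.End F M) (n : ℕ) (f : HC F A M n) :
    hoch l r n f = leading l n f + trailing r n f := rfl

/-- The left action of a bimodule as a linear map. -/
def Bimod.leftL (S : Bimod F A M) : A →ₗ[F] Module.End F M := S.left.toLinearMap

/-- The right action of a bimodule as a linear map. -/
def Bimod.rightL (S : Bimod F A M) : A →ₗ[F] Module.End F M :=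
  S.right.toLinearMap ∘ₗ (MulOpposite.opLinearEquiv F).toLinearMap

lemma Bimod.leftL_apply (S : Bimod F A M) (a : A) (m : M) : S.leftL a m = S.lact a m := rfl

lemma Bimod.rightL_apply (S : Bimod F A M) (a : A) (m : M) : S.rightL a m = S.ract m a := rfl

lemma contractNth_zero_cons {n : ℕ} (a : A) (v : Fin (n + 1) → A) :
    Fin.contractNth (0 : Fin (n + 2)) (· * ·) (Fin.cons a v : Fin (n + 2) → A) =
      Fin.cons (a * v 0) (Fin.tail v) := by
  funext k
  refine Fin.cases ?_ (fun k => ?_) k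
  · simp [Fin.contractNth]
  · simp [Fin.contractNth, Fin.tail]

lemma contractNth_succ_cons {n : ℕ} (j : Fin (n + 1)) (a : A) (v : Fin (n + 1) → A) :
    Fin.contractNth j.succ (· * ·) (Fin.cons a v : Fin (n + 2) → A) =
      Fin.cons a (Fin.contractNth j (· * ·) v) := by
  funext k
  refine Fin.cases ?_ (fun k => ?_) k
  · simp [Fin.contractNth]
  · simp only [Fin.contractNth, Fin.cons_succ, Fin.val_succ, Nat.add_lt_add_iff_right,
      Nat.add_right_cancel_iff, ← Fin.succ_castSucc]

/-- Once the first argument is fixed, the contraction of the first two arguments is `absorb`. Every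
other face is a face of the slice with its index lowered by one, which accounts for the minus sign
in the recursion. -/
lemma trailing_apply (r : A →ₗ[F] Module.End F M) (n : ℕ) (f : HC F A M n) (v : Fin (n + 1) → A) :
    trailing r n f v = ∑ j : Fin n, (-1 : F) ^ (j.val + 1) •
        f (Fin.contractNth j.castSucc (· * ·) v)
      + (-1 : F) ^ (n + 1) • r (v (Fin.last n)) (f (Fin.init v)) := by
  induction n with
  | zero =>
    rw [apply_eq_slice, slice_trailing_zero]
    simp only [neg_apply, postComp_apply, Finset.univ_eq_empty, Finset.sum_empty,
      zero_add, pow_one, neg_smul, one_smul]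
    congr 3
    exact Subsingleton.elim _ _
  | succ n ih =>
    rw [← Fin.cons_self_tail v]
    generalize v 0 = a
    generalize Fin.tail v = v
    rw [← slice_apply, slice_trailing_succ, Fin.sum_univ_succ]
    simp only [sub_apply, neg_apply, ih]
    rw [apply_eq_slice (absorb n f a), slice_absorb]
    simp only [slice_apply, Fin.castSucc_zero, contractNth_zero_cons, ← Fin.succ_castSucc,
      contractNth_succ_cons, Fin.val_succ, Fin.val_zero]
    have h1 : (Fin.init (Fin.cons a v : Fin (n + 2) → A)) = Fin.cons a (Fin.init v) := by
      funext k
      refine Fin.cases ?_ (fun k => ?_) k <;> simp [Fin.init]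
    have h2 : (Fin.cons a v : Fin (n + 2) → A) (Fin.last (n + 1)) = v (Fin.last n) := by
      rw [← Fin.succ_last, Fin.cons_succ]
    rw [h1, h2]
    simp only [pow_succ _ (_ + 1), mul_neg_one, neg_smul, Finset.sum_neg_distrib]
    simp
    abel

lemma dAlg_eq_hoch (S : Bimod F A M) (n : ℕ) : dAlg S n = hoch S.leftL S.rightL n := by
  refine LinearMap.ext fun f => MultilinearMap.ext fun v => ?_
  rw [dAlg_apply, hoch_apply, add_apply, trailing_apply,
    apply_eq_slice (leading _ _ _), slice_leading]
  simp only [postComp_apply, Bimod.leftL_apply, Bimod.rightL_apply, add_assoc]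

end Slices

/-! ### Naturality of the differential, cup products with derivations, and ∂² = 0. -/

section HochschildCalculus

variable {F : Type u} [Field F] {A : Type v} [Ring A] [Algebra F A]
  {B : Type w} [Ring B] [Algebra F B] {M : Type x} [AddCommGroup M] [Module F M]
  {N : Type y} [AddCommGroup N] [Module F N]

lemma postComp_leading {M' N' : Type*} [AddCommGroup M'] [Module F M'] [AddCommGroup N']
    [Module F N'] {l : A →ₗ[F] M →ₗ[F] M'} {k : A →ₗ[F] N →ₗ[F] N'} {g : M →ₗ[F] N}
    {g' : M' →ₗ[F] N'} (h : ∀ a m, g' (l a m) = k a (g m)) (n : ℕ) (f : HC F A M n) :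
    postComp g' (n + 1) (leading l n f) = leading k n (postComp g n f) := by
  refine slice_ext fun a => ?_
  rw [slice_postComp, slice_leading, slice_leading, postComp_postComp, postComp_postComp]
  exact congrArg (fun k => postComp k n f) (LinearMap.ext (h a))

lemma pull_leading (θ : A →ₗ[F] B) (l : B →ₗ[F] M →ₗ[F] N) (n : ℕ) (f : HC F B M n) :
    pull θ (n + 1) (leading l n f) = leading (l ∘ₗ θ) n (pull θ n f) := by
  refine slice_ext fun a => ?_
  rw [slice_pull, slice_leading, slice_leading, pull_postComp]
  rfl

lemma pull_absorb {θ : A →ₗ[F] B} (hθ : ∀ a b, θ (a * b) = θ a * θ b) (n : ℕ)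
    (f : HC F B M (n + 1)) (a : A) :
    pull θ (n + 1) (absorb n f (θ a)) = absorb n (pull θ (n + 1) f) a := by
  refine slice_ext fun b => ?_
  simp [hθ]

lemma postComp_trailing {r : A →ₗ[F] Module.End F M} {r' : A →ₗ[F] Module.End F N}
    {g : M →ₗ[F] N} (h : ∀ a m, g (r a m) = r' a (g m)) (n : ℕ) (f : HC F A M n) :
    postComp g (n + 1) (trailing r n f) = trailing r' n (postComp g n f) := by
  induction n with
  | zero =>
    refine slice_ext fun a => ?_
    rw [slice_postComp, slice_trailing_zero, slice_trailing_zero, map_neg, postComp_postComp,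
      postComp_postComp]
    exact congrArg (fun k => -postComp k 0 f) (LinearMap.ext (h a))
  | succ n ih =>
    refine slice_ext fun a => ?_
    simp [ih, absorb_postComp]

lemma pull_trailing {θ : A →ₗ[F] B} (hθ : ∀ a b, θ (a * b) = θ a * θ b)
    (r : B →ₗ[F] Module.End F M) (n : ℕ) (f : HC F B M n) :
    pull θ (n + 1) (trailing r n f) = trailing (r ∘ₗ θ) n (pull θ n f) := by
  induction n with
  | zero =>
    refine slice_ext fun a => ?_
    rw [slice_pull, slice_trailing_zero, slice_trailing_zero, map_neg, pull_postComp]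
    rfl
  | succ n ih =>
    refine slice_ext fun a => ?_
    simp [ih, pull_absorb hθ]

lemma postComp_hoch {l r : A →ₗ[F] Module.End F M} {l' r' : A →ₗ[F] Module.End F N}
    {g : M →ₗ[F] N} (hl : ∀ a m, g (l a m) = l' a (g m)) (hr : ∀ a m, g (r a m) = r' a (g m))
    (n : ℕ) (f : HC F A M n) :
    postComp g (n + 1) (hoch l r n f) = hoch l' r' n (postComp g n f) := by
  rw [hoch_apply, hoch_apply, map_add, postComp_leading hl, postComp_trailing hr]

lemma pull_hoch {θ : A →ₗ[F] B} (hθ : ∀ a b, θ (a * b) = θ a * θ b)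
    (l r : B →ₗ[F] Module.End F M) (n : ℕ) (f : HC F B M n) :
    pull θ (n + 1) (hoch l r n f) = hoch (l ∘ₗ θ) (r ∘ₗ θ) n (pull θ n f) := by
  rw [hoch_apply, hoch_apply, map_add, pull_leading, pull_trailing hθ]

/-- Only the first contraction involves the argument of δ. The other faces take place behind δ(a)
and pass through it, because δ(a) intertwines the right actions. -/
lemma slice_trailing_leading {δ : A →ₗ[F] M →ₗ[F] N} {r : A →ₗ[F] Module.End F M}
    {r' : A →ₗ[F] Module.End F N} (h : ∀ a b m, r' b (δ a m) = δ a (r b m)) (n : ℕ)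
    (f : HC F A M n) (a : A) :
    slice (n + 1) (trailing r' (n + 1) (leading δ n f)) a =
      -leading (δ ∘ₗ LinearMap.mulLeft F a) n f - postComp (δ a) (n + 1) (trailing r n f) := by
  rw [slice_trailing_succ, slice_leading, postComp_trailing fun b m => (h a b m).symm]
  congr 2

/-- The cup product with a derivation `δ` on the left anticommutes with the differential. -/
lemma hoch_leading {δ : A →ₗ[F] M →ₗ[F] N} {l r : A →ₗ[F] Module.End F M}
    {l' r' : A →ₗ[F] Module.End F N} (h : ∀ a b m, r' b (δ a m) = δ a (r b m))
    (hδ : ∀ a b m, δ (a * b) m = δ a (l b m) + l' a (δ b m)) (n : ℕ) (f : HC F A M n) :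
    hoch l' r' (n + 1) (leading δ n f) = -leading δ (n + 1) (hoch l r n f) := by
  refine slice_ext fun a => ?_
  rw [hoch_apply, map_add, LinearMap.add_apply, slice_trailing_leading h, slice_leading, map_neg,
    LinearMap.neg_apply, slice_leading, hoch_apply, map_add]
  have : leading (δ ∘ₗ LinearMap.mulLeft F a) n f =
      postComp (δ a) (n + 1) (leading l n f) + postComp (l' a) (n + 1) (leading δ n f) := by
    refine slice_ext fun b => MultilinearMap.ext fun v => ?_
    simp [postComp_apply, hδ]
  rw [this]
  abel

lemma trailing_trailing {r : A →ₗ[F] Module.End F M} (hr : ∀ a b m, r (a * b) m = r b (r a m))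
    (n : ℕ) (f : HC F A M n) : trailing r (n + 1) (trailing r n f) = 0 := by
  induction n with
  | zero =>
    refine slice_ext fun a => slice_ext fun b => MultilinearMap.ext fun v => ?_
    simp [postComp_apply, hr]
  | succ n ih =>
    refine slice_ext fun a => ?_
    rw [slice_trailing_succ, slice_trailing_succ, map_sub, ih, map_neg]
    refine slice_ext fun b => ?_
    have h : absorb n (absorb n f a) b = absorb n f (a * b) := by
      refine slice_ext fun c => ?_
      simp [mul_assoc]
    simp [h]
    abel

/-- The trailing part squares to zero by itself. The terms containing the left action then cancel by
its multiplicativity and its commutation with the right action. -/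
lemma hoch_hoch {l r : A →ₗ[F] Module.End F M} (hl : ∀ a b m, l (a * b) m = l a (l b m))
    (hr : ∀ a b m, r (a * b) m = r b (r a m)) (hlr : ∀ a b m, r b (l a m) = l a (r b m))
    (n : ℕ) (f : HC F A M n) : hoch l r (n + 1) (hoch l r n f) = 0 := by
  rw [hoch_apply, hoch_apply, map_add (trailing r (n + 1)), trailing_trailing hr]
  refine slice_ext fun a => ?_
  have : leading (l ∘ₗ LinearMap.mulLeft F a) n f = postComp (l a) (n + 1) (leading l n f) := by
    refine slice_ext fun b => MultilinearMap.ext fun v => ?_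
    simp [postComp_apply, hl]
  rw [map_add, LinearMap.add_apply, slice_leading, map_add (slice (n + 1)), LinearMap.add_apply,
    slice_trailing_leading hlr, this, map_add]
  simp

lemma dAlg_dAlg (S : Bimod F A M) (n : ℕ) (f : HC F A M n) :
    dAlg S (n + 1) (dAlg S n f) = 0 := by
  rw [dAlg_eq_hoch, dAlg_eq_hoch]
  exact hoch_hoch (fun a b m => S.mul_lact a b m) (fun a b m => S.ract_mul a b m)
    (fun a b m => S.ract_lact a b m) n f

end HochschildCalculus

/-! ### The map Φ by recursion, and its compatibility with the Hochschild differential. -/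

section Phi

variable {F : Type u} [Field F] {A : Type v} [Ring A] [Algebra F A]
  {B : Type w} [Ring B] [Algebra F B] {M : Type x} [AddCommGroup M] [Module F M]
  {N : Type y} [AddCommGroup N] [Module F N]

/-- The recursive description of the map `Φ` for operators `d` on `A` and `e` on `M`. -/
def phi (lam : F) (d : A →ₗ[F] A) (e : M →ₗ[F] M) : ∀ n, HC F A M n →ₗ[F] HC F A M n
  | 0 => -postComp e 0
  | n + 1 => (slice n).symm.toLinearMap ∘ₗ
      LinearMap.mk₂ F (fun f a => phi lam d e n (slice n f (a + lam • d a)) + slice n f (d a)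
          + lam • postComp e n (slice n f (d a)))
        (fun f g a => by simp only [map_add, LinearMap.add_apply, smul_add]; abel)
        (fun c f a => by simp only [map_smul, LinearMap.smul_apply, smul_add, smul_comm lam c])
        (fun f a b => by simp only [map_add, smul_add]; abel)
        (fun c f a => by simp only [map_smul, map_add, smul_add, smul_comm lam c])

@[simp] lemma slice_phi (lam : F) (d : A →ₗ[F] A) (e : M →ₗ[F] M) (n : ℕ) (f : HC F A M (n + 1))
    (a : A) : slice n (phi lam d e (n + 1) f) a = phi lam d e n (slice n f (a + lam • d a))
      + slice n f (d a) + lam • postComp e n (slice n f (d a)) := by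
  simp [phi]

lemma sum_finset_fin_succ {E : Type*} [AddCommMonoid E] (n : ℕ) (g : Finset (Fin (n + 1)) → E) :
    ∑ s, g s = ∑ s : Finset (Fin n),
      (g (s.map (Fin.succEmb n)) + g (insert 0 (s.map (Fin.succEmb n)))) := by
  classical
  rw [← Finset.powerset_univ, Fin.univ_succ, Finset.cons_eq_insert,
    Finset.sum_powerset_insert (by simp), Finset.sum_add_distrib]
  have h : ∀ k : Finset (Fin (n + 1)) → E,
      ∑ t ∈ (Finset.univ.map (⟨Fin.succ, Fin.succ_injective n⟩ : Fin n ↪ Fin (n + 1))).powerset, k t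
        = ∑ s : Finset (Fin n), k (s.map (Fin.succEmb n)) := by
    intro k
    have : (Finset.univ.map (⟨Fin.succ, Fin.succ_injective n⟩ : Fin n ↪ Fin (n + 1))).powerset =
        Finset.univ.map (Finset.mapEmbedding (Fin.succEmb n)).toEmbedding := by
      ext t
      simp only [Finset.mem_powerset, Finset.subset_map_iff, Finset.mem_map, Finset.mem_univ,
        Finset.subset_univ, true_and, RelEmbedding.coe_toEmbedding, Finset.mapEmbedding_apply]
      exact ⟨fun ⟨s, hs⟩ => ⟨s, hs.symm⟩, fun ⟨s, hs⟩ => ⟨s, hs.symm⟩⟩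
    rw [this, Finset.sum_map]
    rfl
  rw [h, h]

/-- Split the sets of positions according to whether they contain the first one. The singleton of
the first position yields f(d a, ·). The summand with `lam` and `e` in the recursion compensates for
the -e ∘ f(lam d a, ·) hidden in Φ of the slice at a + lam d a. -/
lemma bigPhi_eq_phi {lam : F} {dA : DiffOp F lam A} (S : DiffBimod dA M) (n : ℕ) :
    bigPhi S n = phi lam dA.d S.d n := by
  -- The sum runs over all sets, with coefficient 0 on the empty one, so that the splitting of sets
  -- applies without side conditions.
  have key : ∀ (n : ℕ) (f : HC F A M n) (v : Fin n → A),
      ∑ s : Finset (Fin n), (if s.Nonempty then lam ^ (s.card - 1) else 0) •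
        f (fun i => if i ∈ s then dA.d (v i) else v i) = phi lam dA.d S.d n f v + S.d (f v) := by
    intro n
    induction n with
    | zero =>
      intro f v
      have h : ∀ s : Finset (Fin 0), ¬ s.Nonempty := fun s ⟨i, _⟩ => i.elim0
      simp [h, phi, postComp_apply]
    | succ n ih =>
      intro f v
      rw [← Fin.cons_self_tail v]
      generalize v 0 = a
      generalize Fin.tail v = v
      have h1 : ∀ s : Finset (Fin n), (fun i => if i ∈ s.map (Fin.succEmb n) then
          dA.d ((Fin.cons a v : Fin (n + 1) → A) i) else (Fin.cons a v : Fin (n + 1) → A) i) =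
          Fin.cons a (fun i => if i ∈ s then dA.d (v i) else v i) := by
        intro s
        funext i
        refine Fin.cases ?_ (fun i => ?_) i <;> simp
      have h2 : ∀ s : Finset (Fin n), (fun i => if i ∈ insert 0 (s.map (Fin.succEmb n)) then
          dA.d ((Fin.cons a v : Fin (n + 1) → A) i) else (Fin.cons a v : Fin (n + 1) → A) i) =
          Fin.cons (dA.d a) (fun i => if i ∈ s then dA.d (v i) else v i) := by
        intro s
        funext i
        refine Fin.cases ?_ (fun i => ?_) i <;> simp
      have h3 : ∀ s : Finset (Fin n), lam ^ s.card = (if s = ∅ then 1 else 0)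
          + lam * (if s.Nonempty then lam ^ (s.card - 1) else 0) := by
        intro s
        rcases s.eq_empty_or_nonempty with rfl | hs
        · simp
        · rw [if_pos hs, if_neg hs.ne_empty, zero_add, ← pow_succ',
            Nat.sub_add_cancel hs.card_pos]
      rw [sum_finset_fin_succ]
      simp only [h1, h2, Finset.map_nonempty, Finset.card_map, Finset.insert_nonempty, if_true]
      have h4 : ∀ s : Finset (Fin n), (insert 0 (s.map (Fin.succEmb n))).card - 1 = s.card := by
        intro s
        rw [Finset.card_insert_of_notMem (by simp), Finset.card_map, Nat.add_sub_cancel]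
      simp only [h4, h3, ← slice_apply, add_smul, mul_smul, Finset.sum_add_distrib,
        ← Finset.smul_sum, ih]
      simp only [ite_smul, zero_smul, one_smul, Finset.sum_ite_eq', Finset.mem_univ, if_true]
      rw [slice_phi]
      simp [postComp_apply]
      abel
  refine LinearMap.ext fun f => MultilinearMap.ext fun v => ?_
  have := key n f v
  rw [← sub_eq_iff_eq_add] at this
  rw [← this]
  simp only [bigPhi, LinearMap.sub_apply, LinearMap.sum_apply, sub_apply, sum_apply,
    postComp_apply, ite_smul, zero_smul, Finset.sum_filter]
  congr 1
  refine Finset.sum_congr rfl fun s _ => ?_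
  split_ifs
  · refine congrArg (fun k => lam ^ (s.card - 1) • f k) ?_
    funext i
    by_cases hi : i ∈ s <;> simp [hi]
  · rfl

lemma pull_phi {lam : F} {d : A →ₗ[F] A} {d' : B →ₗ[F] B} {θ : A →ₗ[F] B}
    (h : ∀ a, θ (d a) = d' (θ a)) (e : M →ₗ[F] M) (n : ℕ) (f : HC F B M n) :
    pull θ n (phi lam d' e n f) = phi lam d e n (pull θ n f) := by
  induction n with
  | zero => rfl
  | succ n ih =>
    refine slice_ext fun a => ?_
    simp [ih, h, pull_postComp]

lemma postComp_phi {lam : F} {e : M →ₗ[F] M} {e' : N →ₗ[F] N} {g : M →ₗ[F] N}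
    (h : ∀ m, g (e m) = e' (g m)) (d : A →ₗ[F] A) (n : ℕ) (f : HC F A M n) :
    postComp g n (phi lam d e n f) = phi lam d e' n (postComp g n f) := by
  have hp : ∀ (n : ℕ) (f : HC F A M n),
      postComp g n (postComp e n f) = postComp e' n (postComp g n f) := by
    intro n f
    rw [postComp_postComp, postComp_postComp]
    exact congrArg (fun k => postComp k n f) (LinearMap.ext h)
  induction n with
  | zero =>
    simp only [phi, LinearMap.neg_apply, map_neg, hp]
  | succ n ih =>
    refine slice_ext fun a => ?_
    simp [ih, hp]

/-- This form suits the trailing part of the differential: id + lam e intertwines an action with its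
twist by id + lam d. -/
lemma slice_phi_twist (lam : F) (d : A →ₗ[F] A) (e : M →ₗ[F] M) (n : ℕ)
    (f : HC F A M (n + 1)) (a : A) :
    slice n (phi lam d e (n + 1) f) a = phi lam d e n (slice n f (a + lam • d a))
      + postComp (LinearMap.id + lam • e) n (slice n f (d a)) := by
  rw [slice_phi, add_assoc]
  rfl

/-- The commutator of `Φ` with postcomposition by `g`. -/
lemma phi_postComp (lam : F) (d : A →ₗ[F] A) (e g : M →ₗ[F] M) (n : ℕ) (f : HC F A M n) :
    phi lam d e n (postComp g n f) =
      postComp g n (phi lam d e n f) + postComp (g ∘ₗ e - e ∘ₗ g) n f := by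
  induction n with
  | zero =>
    ext v
    simp [phi, postComp_apply]
    abel
  | succ n ih =>
    refine slice_ext fun a => ?_
    simp only [map_add, LinearMap.add_apply, slice_phi, slice_postComp, ih, map_smul]
    ext v
    simp only [add_apply, smul_apply, postComp_apply, LinearMap.sub_apply, LinearMap.comp_apply,
      smul_add, smul_sub]
    abel

lemma phi_leading {lam : F} {d : A →ₗ[F] A} {e : M →ₗ[F] M} {l : A →ₗ[F] Module.End F M}
    (h : ∀ a m, e (l a m) = l (d a) m + l (a + lam • d a) (e m)) (n : ℕ) (f : HC F A M n) :
    phi lam d e (n + 1) (leading l n f) =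
      leading (l ∘ₗ (LinearMap.id + lam • d)) n (phi lam d e n f) := by
  refine slice_ext fun a => ?_
  rw [slice_phi, slice_leading, slice_leading, slice_leading, phi_postComp, add_assoc, add_assoc,
    LinearMap.comp_apply]
  change _ = postComp (l (a + lam • d a)) n (phi lam d e n f)
  rw [add_eq_left]
  ext v
  simp only [add_apply, smul_apply, postComp_apply, LinearMap.sub_apply, LinearMap.comp_apply, h,
    map_add, map_smul, LinearMap.add_apply, LinearMap.smul_apply, smul_add, zero_apply]
  abel

/-- The weighted Leibniz rule enters in two forms: id + lam d is multiplicative, and d(ab) = (a +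
lam d a) d b + d a · b. -/
lemma phi_absorb {lam : F} {d : A →ₗ[F] A} (hd : ∀ a b, d (a * b) = d a * b + a * d b
    + lam • (d a * d b)) (e : M →ₗ[F] M) (n : ℕ) (f : HC F A M (n + 1)) (a : A) :
    phi lam d e (n + 1) (absorb n f (a + lam • d a))
      + postComp (LinearMap.id + lam • e) (n + 1) (absorb n f (d a)) =
    absorb n (phi lam d e (n + 1) f) a := by
  refine slice_ext fun b => ?_
  rw [map_add, LinearMap.add_apply, slice_phi_twist, slice_postComp, slice_absorb, slice_absorb,
    slice_absorb, slice_absorb, slice_phi_twist, add_assoc, ← map_add, ← map_add]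
  have h1 : (a + lam • d a) * (b + lam • d b) = a * b + lam • d (a * b) := by
    simp only [hd, add_mul, mul_add, smul_add, smul_mul_assoc, mul_smul_comm]
    abel
  have h2 : (a + lam • d a) * d b + d a * b = d (a * b) := by
    simp only [hd, add_mul, smul_mul_assoc]
    abel
  rw [h1, h2]

lemma phi_trailing {lam : F} {d : A →ₗ[F] A} {e : M →ₗ[F] M} {r : A →ₗ[F] Module.End F M}
    (hd : ∀ a b, d (a * b) = d a * b + a * d b + lam • (d a * d b))
    (h : ∀ a m, e (r a m) = r (d a) m + r (a + lam • d a) (e m)) (n : ℕ) (f : HC F A M n) :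
    phi lam d e (n + 1) (trailing r n f) =
      trailing (r ∘ₗ (LinearMap.id + lam • d)) n (phi lam d e n f) := by
  have hg : ∀ a m, (LinearMap.id + lam • e : M →ₗ[F] M) (r a m) =
      (r ∘ₗ (LinearMap.id + lam • d)) a ((LinearMap.id + lam • e : M →ₗ[F] M) m) := by
    intro a m
    simp [h]
    abel
  induction n with
  | zero =>
    refine slice_ext fun a => MultilinearMap.ext fun v => ?_
    simp [phi, postComp_apply, h]
    abel
  | succ n ih =>
    refine slice_ext fun a => ?_
    rw [slice_phi_twist, slice_trailing_succ, slice_trailing_succ, slice_trailing_succ,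
      ← phi_absorb hd, map_sub, map_sub, map_neg, map_neg, ih, slice_phi_twist,
      map_add (trailing (r ∘ₗ (LinearMap.id + lam • d)) n), postComp_trailing hg]
    abel

/-- Conceptually lam Φ(f) = f ∘ (id + lam d_A)^{⊗n} - (id + lam d_M) ∘ f, and both terms are cochain
maps to the twisted coefficients. The recursive proof avoids dividing by `lam`, so weight zero is
included. -/
lemma bigPhi_dAlg {lam : F} {dA : DiffOp F lam A} (S : DiffBimod dA M) (n : ℕ) (f : HC F A M n) :
    bigPhi S (n + 1) (dAlg S.toBimod n f) = dAlg S.tri n (bigPhi S n f) := by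
  rw [bigPhi_eq_phi, bigPhi_eq_phi, dAlg_eq_hoch, dAlg_eq_hoch, hoch_apply, hoch_apply, map_add,
    phi_leading, phi_trailing dA.d_mul]
  · rfl
  · intro a m
    simp only [Bimod.rightL_apply, S.d_ract, Bimod.ract_add, Bimod.ract_smul, add_assoc]
  · intro a m
    simp only [Bimod.leftL_apply, S.d_lact, Bimod.add_lact, Bimod.smul_lact, add_assoc]

end Phi

/-! ### Insertion homotopies. -/

section Homotopy

variable {F : Type u} [Field F] {R : Type v} [Ring R] [Algebra F R]
  {L : Type w} [Ring L] [Algebra F L] {M : Type x} [AddCommGroup M] [Module F M]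
  {N : Type y} [AddCommGroup N] [Module F N] {I : Type*} [Fintype I]

/-- The cochain homotopy given by inserting the column `e` between the arguments: to its left
the arguments are transported by the matrix of maps `Θ`, to its right by the map `θ`. -/
def insertion (θ : R →ₗ[F] L) (Θ : I → I → R →ₗ[F] L) (e : I → L) :
    ∀ n, I → (HC F L M (n + 1) →ₗ[F] HC F R M n)
  | 0, i => pull θ 0 ∘ₗ LinearMap.applyₗ (e i) ∘ₗ (slice 0).toLinearMap
  | n + 1, i => pull θ (n + 1) ∘ₗ LinearMap.applyₗ (e i) ∘ₗ (slice (n + 1)).toLinearMap -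
      (slice n).symm.toLinearMap ∘ₗ
        LinearMap.mk₂ F (fun f a => ∑ j, insertion θ Θ e n j (slice (n + 1) f (Θ i j a)))
          (fun f g a => by simp only [map_add, LinearMap.add_apply, Finset.sum_add_distrib])
          (fun c f a => by simp only [map_smul, LinearMap.smul_apply, Finset.smul_sum])
          (fun f a b => by simp only [map_add, Finset.sum_add_distrib])
          (fun c f a => by simp only [map_smul, Finset.smul_sum])

variable (θ : R →ₗ[F] L) (Θ : I → I → R →ₗ[F] L) (e : I → L)

lemma insertion_zero (i : I) (f : HC F L M 1) :
    insertion θ Θ e 0 i f = pull θ 0 (slice 0 f (e i)) := rfl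

lemma slice_insertion (n : ℕ) (i : I) (f : HC F L M (n + 2)) (a : R) :
    slice n (insertion θ Θ e (n + 1) i f) a = pull θ n (slice n (slice (n + 1) f (e i)) (θ a))
      - ∑ j, insertion θ Θ e n j (slice (n + 1) f (Θ i j a)) := by
  simp [insertion]

/-- The cochain `f` with arguments transported by the matrix `Θ`, multiplied on the right by the
column `e`. -/
def columnMul (r : L →ₗ[F] Module.End F M) : ∀ n, I → (HC F L M n →ₗ[F] HC F R M n)
  | 0, i => pull θ 0 ∘ₗ postComp (r (e i)) 0
  | n + 1, i => (slice n).symm.toLinearMap ∘ₗ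
      LinearMap.mk₂ F (fun f a => ∑ j, columnMul r n j (slice n f (Θ i j a)))
        (fun f g a => by simp only [map_add, LinearMap.add_apply, Finset.sum_add_distrib])
        (fun c f a => by simp only [map_smul, LinearMap.smul_apply, Finset.smul_sum])
        (fun f a b => by simp only [map_add, Finset.sum_add_distrib])
        (fun c f a => by simp only [map_smul, Finset.smul_sum])

lemma columnMul_zero (r : L →ₗ[F] Module.End F M) (i : I) (f : HC F L M 0) :
    columnMul θ Θ e r 0 i f = pull θ 0 (postComp (r (e i)) 0 f) := rfl

lemma slice_columnMul (r : L →ₗ[F] Module.End F M) (n : ℕ) (i : I) (f : HC F L M (n + 1)) (a : R) :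
    slice n (columnMul θ Θ e r (n + 1) i f) a =
      ∑ j, columnMul θ Θ e r n j (slice n f (Θ i j a)) := by
  simp [columnMul]

lemma insertion_postComp (g : M →ₗ[F] N) (n : ℕ) (i : I) (f : HC F L M (n + 1)) :
    insertion θ Θ e n i (postComp g (n + 1) f) = postComp g n (insertion θ Θ e n i f) := by
  induction n generalizing i with
  | zero => rfl
  | succ n ih =>
    refine slice_ext fun a => ?_
    simp [slice_insertion, ih, pull_postComp]

lemma pull_insertion {R' : Type*} [Ring R'] [Algebra F R'] (α : R' →ₗ[F] R) (n : ℕ) (i : I)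
    (f : HC F L M (n + 1)) :
    pull α n (insertion θ Θ e n i f) =
      insertion (θ ∘ₗ α) (fun i j => Θ i j ∘ₗ α) e n i f := by
  induction n generalizing i with
  | zero => rfl
  | succ n ih =>
    refine slice_ext fun a => ?_
    simp [slice_insertion, ih, pull_pull]

lemma insertion_pull {L' : Type*} [Ring L'] [Algebra F L'] (β : L →ₗ[F] L') (n : ℕ) (i : I)
    (f : HC F L' M (n + 1)) :
    insertion θ Θ e n i (pull β (n + 1) f) =
      insertion (β ∘ₗ θ) (fun i j => β ∘ₗ Θ i j) (fun i => β (e i)) n i f := by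
  induction n generalizing i with
  | zero =>
    rw [insertion_zero, insertion_zero, slice_pull, pull_pull]
  | succ n ih =>
    refine slice_ext fun a => ?_
    simp [slice_insertion, ih, pull_pull]

lemma insertion_leading_zero (l : L →ₗ[F] M →ₗ[F] N) (i : I) (f : HC F L M 0) :
    insertion θ Θ e 0 i (leading l 0 f) = postComp (l (e i)) 0 (pull θ 0 f) := by
  rw [insertion_zero, slice_leading, pull_postComp]

lemma insertion_leading_succ (l : L →ₗ[F] M →ₗ[F] N) (n : ℕ) (i : I) (f : HC F L M (n + 1)) :
    insertion θ Θ e (n + 1) i (leading l (n + 1) f) =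
      postComp (l (e i)) (n + 1) (pull θ (n + 1) f)
        - ∑ j, leading (l ∘ₗ Θ i j) n (insertion θ Θ e n j f) := by
  refine slice_ext fun a => ?_
  simp [slice_insertion, insertion_postComp, pull_postComp]

variable {θ Θ e}

lemma insertion_trailing_zero (r : L →ₗ[F] Module.End F M) (i : I) (f : HC F L M 0) :
    insertion θ Θ e 0 i (trailing r 0 f) = -columnMul θ Θ e r 0 i f := by
  rw [insertion_zero, slice_trailing_zero, map_neg, columnMul_zero]

lemma insertion_trailing_succ (hθ : ∀ a b, θ (a * b) = θ a * θ b)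
    (hΘ : ∀ i k a b, Θ i k (a * b) = ∑ j, Θ i j a * Θ j k b)
    (he : ∀ i a, e i * θ a = ∑ j, Θ i j a * e j)
    (r : L →ₗ[F] Module.End F M) (n : ℕ) (i : I) (f : HC F L M (n + 1)) :
    insertion θ Θ e (n + 1) i (trailing r (n + 1) f) =
      -trailing (r ∘ₗ θ) n (insertion θ Θ e n i f) - columnMul θ Θ e r (n + 1) i f := by
  induction n generalizing i with
  | zero =>
    refine slice_ext fun a => ?_
    simp only [slice_insertion, insertion_zero, slice_trailing_succ, slice_trailing_zero, map_sub,
      map_neg, LinearMap.sub_apply, LinearMap.neg_apply, slice_absorb, slice_columnMul,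
      columnMul_zero, Finset.sum_sub_distrib, Finset.sum_neg_distrib, ← map_sum, ← he,
      pull_postComp, LinearMap.comp_apply]
    abel
  | succ n ih =>
    refine slice_ext fun a => ?_
    -- Here the faces next to the column cancel. By `he` the products Θ(a)·e become e·θ(a), and by
    -- `hΘ` the remaining products become Θ(ab), so the sum is the first contraction of the
    -- insertion up to its leading term.
    have h : ∑ j, insertion θ Θ e (n + 1) j (absorb (n + 1) f (Θ i j a)) =
        absorb n (insertion θ Θ e (n + 1) i f) a
          + pull θ (n + 1) (slice (n + 1) f (e i * θ a))
          - absorb n (pull θ (n + 1) (slice (n + 1) f (e i))) a := by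
      refine slice_ext fun b => ?_
      simp only [map_sum, map_add, map_sub, LinearMap.sum_apply, LinearMap.add_apply,
        LinearMap.sub_apply, slice_insertion, slice_absorb, Finset.sum_sub_distrib, slice_pull, he,
        hθ, hΘ]
      rw [Finset.sum_comm]
      abel
    simp only [slice_insertion, slice_trailing_succ, map_sub, map_neg, LinearMap.sub_apply,
      LinearMap.neg_apply, slice_absorb, slice_columnMul, Finset.sum_sub_distrib, map_sum,
      Finset.sum_neg_distrib, ih, h, pull_trailing hθ, ← pull_absorb hθ]
    abel

/-- The homotopy formula in positive degree. -/
lemma insertion_hoch_succ (hθ : ∀ a b, θ (a * b) = θ a * θ b)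
    (hΘ : ∀ i k a b, Θ i k (a * b) = ∑ j, Θ i j a * Θ j k b)
    (he : ∀ i a, e i * θ a = ∑ j, Θ i j a * e j)
    (l r : L →ₗ[F] Module.End F M) (n : ℕ) (i : I) (f : HC F L M (n + 1)) :
    insertion θ Θ e (n + 1) i (hoch l r (n + 1) f) =
      postComp (l (e i)) (n + 1) (pull θ (n + 1) f)
        - ∑ j, leading (l ∘ₗ Θ i j) n (insertion θ Θ e n j f)
        - trailing (r ∘ₗ θ) n (insertion θ Θ e n i f) - columnMul θ Θ e r (n + 1) i f := by
  rw [hoch_apply, map_add, insertion_leading_succ, insertion_trailing_succ hθ hΘ he]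
  abel

lemma insertion_hoch_zero (l r : L →ₗ[F] Module.End F M) (i : I) (f : HC F L M 0) :
    insertion θ Θ e 0 i (hoch l r 0 f) =
      postComp (l (e i)) 0 (pull θ 0 f) - columnMul θ Θ e r 0 i f := by
  rw [hoch_apply, map_add, insertion_leading_zero, insertion_trailing_zero, sub_eq_add_neg]

lemma columnMul_eq_zero {r : L →ₗ[F] Module.End F M} (h : ∀ i, r (e i) = 0) (n : ℕ) (i : I)
    (f : HC F L M n) : columnMul θ Θ e r n i f = 0 := by
  induction n generalizing i with
  | zero => rw [columnMul_zero, h, postComp_zero, map_zero]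
  | succ n ih =>
    refine slice_ext fun a => ?_
    simp [slice_columnMul, ih]

lemma columnMul_unique [Unique I] (r : L →ₗ[F] Module.End F M) (n : ℕ) (i : I)
    (f : HC F L M n) :
    columnMul θ Θ e r n i f = postComp (r (e default)) n (pull (Θ default default) n f) := by
  induction n generalizing i with
  | zero =>
    rw [Unique.eq_default i, columnMul_zero, pull_postComp, pull_zero_congr]
  | succ n ih =>
    refine slice_ext fun a => ?_
    simp [slice_columnMul, ih, Unique.eq_default i]

/-- A row of the matrix that vanishes outside of the diagonal can be treated separately. -/
lemma insertion_eq_of_row [DecidableEq I] {i : I} (h : ∀ j, j ≠ i → Θ i j = 0) (n : ℕ)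
    (f : HC F L M (n + 1)) :
    insertion θ Θ e n i f =
      insertion θ (fun _ _ : Unit => Θ i i) (fun _ => e i) n () f := by
  induction n with
  | zero => rfl
  | succ n ih =>
    refine slice_ext fun a => ?_
    rw [slice_insertion, slice_insertion, Finset.sum_eq_single i, ih,
      Fintype.sum_unique]
    · intro j _ hj
      rw [h j hj]
      simp
    · simp

/-- The insertion of an element killed by the operator `d'` commutes with `Φ`. -/
lemma insertion_phi {lam : F} {d : R →ₗ[F] R} {d' : L →ₗ[F] L} (hθ : ∀ a, θ (d a) = d' (θ a))
    (hΘ : ∀ i j a, Θ i j (d a) = d' (Θ i j a)) (he : ∀ i, d' (e i) = 0) (E : M →ₗ[F] M) (n : ℕ)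
    (i : I) (f : HC F L M (n + 1)) :
    insertion θ Θ e n i (phi lam d' E (n + 1) f) = phi lam d E n (insertion θ Θ e n i f) := by
  induction n generalizing i with
  | zero =>
    rw [insertion_zero, insertion_zero, slice_phi, he]
    simp only [smul_zero, add_zero, map_zero]
    exact pull_phi hθ E 0 _
  | succ n ih =>
    refine slice_ext fun a => ?_
    simp only [slice_insertion, slice_phi, he, smul_zero, add_zero, map_zero, map_add, ih,
      pull_phi hθ, hθ, hΘ, map_sub, map_smul, map_sum, pull_postComp,
      insertion_postComp, Finset.sum_add_distrib, smul_sub, Finset.smul_sum]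
    abel

variable (θ e) in
/-- The insertion of a single element `e`, as a map from cochains to shifted cochains. -/
def insertShift (θ' : R →ₗ[F] L) (e : L) : ∀ n, HC F L M n →ₗ[F] Shift (HC F R M) n
  | 0 => 0
  | n + 1 => insertion θ (fun _ _ : Unit => θ') (fun _ => e) n ()

/-- The homotopy formula for the insertion of a single element. -/
lemma insertShift_hoch {θ' : R →ₗ[F] L} {e : L} (hθ : ∀ a b, θ (a * b) = θ a * θ b)
    (hθ' : ∀ a b, θ' (a * b) = θ' a * θ' b) (he : ∀ a, e * θ a = θ' a * e)
    (l r : L →ₗ[F] Module.End F M) (n : ℕ) (f : HC F L M n) :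
    insertion θ (fun _ _ : Unit => θ') (fun _ => e) n () (hoch l r n f) =
      postComp (l e) n (pull θ n f)
        - shiftD (hoch (l ∘ₗ θ') (r ∘ₗ θ)) n (insertShift θ θ' e n f)
        - postComp (r e) n (pull θ' n f) := by
  cases n with
  | zero =>
    refine (insertion_hoch_zero l r () f).trans ?_
    rw [columnMul_unique]
    change _ = _ - (0 : HC F R M 0) - _
    rw [sub_zero]
  | succ n =>
    refine (insertion_hoch_succ hθ (fun _ _ a b => by simp [hθ']) (fun _ a => by simp [he]) l r n ()
      f).trans ?_
    rw [columnMul_unique, Fintype.sum_unique]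
    change _ = _ - (leading _ n (insertion _ _ _ n _ f) + trailing _ n (insertion _ _ _ n _ f)) - _
    abel

end Homotopy

/-! ### Exactness of cocycles on the mapping algebra, one summand of the coefficients at a time. -/

section MappingAlgebra

variable {F : Type u} [Field F] {A : Type v} [Ring A] [Algebra F A]
  {B : Type w} [Ring B] [Algebra F B] {M : Type x} [AddCommGroup M] [Module F M]
  {N : Type y} [AddCommGroup N] [Module F N]

namespace MapAlg

variable (φ : A →ₐ[F] B)

/-- The inclusion of `A` in `φ!`. -/
def inA : A →ₗ[F] MapAlg φ where
  toFun a := mk φ a 0 0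
  map_add' _ _ := by ext <;> simp
  map_smul' _ _ := by ext <;> simp

/-- The inclusion of `B` in `φ!`. -/
def inB : B →ₗ[F] MapAlg φ where
  toFun b := mk φ 0 b 0
  map_add' _ _ := by ext <;> simp
  map_smul' _ _ := by ext <;> simp

/-- The projection of `φ!` to `A`. -/
def prA : MapAlg φ →ₗ[F] A where
  toFun x := x.1
  map_add' _ _ := rfl
  map_smul' _ _ := rfl

/-- The projection of `φ!` to `B`. -/
def prB : MapAlg φ →ₗ[F] B where
  toFun x := x.2.1
  map_add' _ _ := rfl
  map_smul' _ _ := rfl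

/-- The coefficient of `φ`, a derivation from `φ!` to `B`. -/
def prD : MapAlg φ →ₗ[F] B where
  toFun x := x.2.2
  map_add' _ _ := rfl
  map_smul' _ _ := rfl

/-- The idempotent `1_A` of `φ!`. -/
def eA : MapAlg φ := mk φ 1 0 0

/-- The idempotent `1_B` of `φ!`. -/
def eB : MapAlg φ := mk φ 0 1 0

/-- The element `φ` of `φ!`. -/
def eφ : MapAlg φ := mk φ 0 0 1

variable {φ}

@[simp] lemma inA_apply (a : A) : inA φ a = mk φ a 0 0 := rfl
@[simp] lemma inB_apply (b : B) : inB φ b = mk φ 0 b 0 := rfl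
@[simp] lemma prA_apply (x : MapAlg φ) : prA φ x = x.1 := rfl
@[simp] lemma prB_apply (x : MapAlg φ) : prB φ x = x.2.1 := rfl
@[simp] lemma prD_apply (x : MapAlg φ) : prD φ x = x.2.2 := rfl
@[simp] lemma prA_comp_inA : prA φ ∘ₗ inA φ = LinearMap.id := rfl
@[simp] lemma prB_comp_inB : prB φ ∘ₗ inB φ = LinearMap.id := rfl

lemma inA_mul (a b : A) : inA φ (a * b) = inA φ a * inA φ b := by ext <;> simp
lemma inB_mul (a b : B) : inB φ (a * b) = inB φ a * inB φ b := by ext <;> simp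
lemma prA_mul (x y : MapAlg φ) : prA φ (x * y) = prA φ x * prA φ y := rfl

end MapAlg

open MapAlg

variable {φ : A →ₐ[F] B}

/-- A cocycle of `φ!` with coefficients in an `A`-bimodule whose restriction to `A` vanishes is
the coboundary of a cochain whose restriction to `A` vanishes. -/
lemma exists_primitive_prA (S : Bimod F A M) (n : ℕ) (f : HC F (MapAlg φ) M n)
    (hf : hoch (S.leftL ∘ₗ prA φ) (S.rightL ∘ₗ prA φ) n f = 0) (h : pull (inA φ) n f = 0) :
    ∃ k : Shift (HC F (MapAlg φ) M) n,
      shiftD (hoch (S.leftL ∘ₗ prA φ) (S.rightL ∘ₗ prA φ)) n k = f ∧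
        shiftMap (pull (inA φ)) n k = 0 := by
  -- Since 1_A·x is the A-component of x, inserting 1_A replaces the arguments on its left by their
  -- A-components. The homotopy then joins f to the pullback of its restriction to A, which is zero.
  refine ⟨insertShift LinearMap.id (inA φ ∘ₗ prA φ) (eA φ) n f, ?_, ?_⟩
  · have key := insertShift_hoch (θ := LinearMap.id) (θ' := inA φ ∘ₗ prA φ) (e := eA φ)
      (fun _ _ => rfl) (fun a b => by ext <;> simp) (fun a => by ext <;> simp [eA])
      (S.leftL ∘ₗ prA φ) (S.rightL ∘ₗ prA φ) n f
    have h1 : (S.leftL ∘ₗ prA φ) (eA φ) = LinearMap.id :=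
      LinearMap.ext fun m => S.one_lact m
    rw [hf, map_zero, h1, postComp_id, pull_id, ← pull_pull, h, map_zero, map_zero, sub_zero,
      eq_comm, sub_eq_zero] at key
    exact key.symm
  · cases n with
    | zero => rfl
    | succ n =>
      -- On arguments from A everything, including the inserted 1_A, lies in A. The primitive
      -- therefore restricts to an insertion into the restriction of f.
      refine (pull_insertion _ _ _ _ n () f).trans ?_
      refine (insertion_pull LinearMap.id (fun _ _ => LinearMap.id) (fun _ => (1 : A)) (inA φ) n ()
        f).symm.trans ?_
      rw [h]
      exact map_zero _

/-- A cocycle of `φ!` with coefficients in a `B`-bimodule whose restriction to `B` vanishes is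
the coboundary of a cochain whose restriction to `B` vanishes. -/
lemma exists_primitive_prB (T : Bimod F B N) (n : ℕ) (f : HC F (MapAlg φ) N n)
    (hf : hoch (T.leftL ∘ₗ prB φ) (T.rightL ∘ₗ prB φ) n f = 0) (h : pull (inB φ) n f = 0) :
    ∃ k : Shift (HC F (MapAlg φ) N) n,
      shiftD (hoch (T.leftL ∘ₗ prB φ) (T.rightL ∘ₗ prB φ)) n k = f ∧
        shiftMap (pull (inB φ)) n k = 0 := by
  -- For B the sides are exchanged, because x·1_B is the B-component of x while 1_B·x also retains
  -- b₂φ. So f now appears as the right outer term of the homotopy formula, whence the sign.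
  refine ⟨-insertShift (inB φ ∘ₗ prB φ) LinearMap.id (eB φ) n f, ?_, ?_⟩
  · have key := insertShift_hoch (θ := inB φ ∘ₗ prB φ) (θ' := LinearMap.id) (e := eB φ)
      (fun a b => by ext <;> simp) (fun _ _ => rfl) (fun a => by ext <;> simp [eB])
      (T.leftL ∘ₗ prB φ) (T.rightL ∘ₗ prB φ) n f
    have h1 : (T.rightL ∘ₗ prB φ) (eB φ) = LinearMap.id :=
      LinearMap.ext fun m => T.ract_one m
    rw [hf, map_zero, h1, postComp_id, pull_id, ← pull_pull, h, map_zero, map_zero, zero_sub,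
      eq_comm, sub_eq_zero] at key
    rw [map_neg]
    exact key
  · cases n with
    | zero => rfl
    | succ n =>
      rw [map_neg, neg_eq_zero]
      refine (pull_insertion _ _ _ _ n () f).trans ?_
      refine (insertion_pull LinearMap.id (fun _ _ => LinearMap.id) (fun _ => (1 : B)) (inB φ) n ()
        f).symm.trans ?_
      rw [h]
      exact map_zero _

/-- The action of the coefficient of `φ` on a `B`-bimodule. -/
def actD (T : Bimod F B N) : MapAlg φ →ₗ[F] Module.End F N := T.leftL ∘ₗ prD φ

/-- The left action of `φ!` on the corner `Nφ`. -/
def cornerL (φ : A →ₐ[F] B) (T : Bimod F B N) : MapAlg φ →ₗ[F] Module.End F N :=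
  T.leftL ∘ₗ prB φ

/-- The right action of `φ!` on the corner `Nφ`. -/
def cornerR (φ : A →ₐ[F] B) (T : Bimod F B N) : MapAlg φ →ₗ[F] Module.End F N :=
  (T.restrict φ).rightL ∘ₗ prA φ

lemma cornerL_apply (T : Bimod F B N) (x : MapAlg φ) (m : N) :
    cornerL φ T x m = T.lact x.2.1 m := rfl

lemma cornerR_apply (T : Bimod F B N) (x : MapAlg φ) (m : N) :
    cornerR φ T x m = T.ract m (φ x.1) := rfl

/-- The cup product with the coefficient of `φ`. -/
lemma hoch_corner_leading (T : Bimod F B N) (n : ℕ) (f : HC F (MapAlg φ) N n) :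
    hoch (cornerL φ T) (cornerR φ T) (n + 1) (leading (actD T) n f) =
      -leading (actD T) (n + 1)
        (hoch ((T.restrict φ).leftL ∘ₗ prA φ) ((T.restrict φ).rightL ∘ₗ prA φ) n f) := by
  refine hoch_leading (fun a b m => T.ract_lact _ _ _) (fun a b m => ?_) n f
  change T.lact (a * b).2.2 m = T.lact a.2.2 (T.lact (φ b.1) m) + T.lact a.2.1 (T.lact b.2.2 m)
  rw [mul_trd, T.add_lact, T.mul_lact, T.mul_lact]

/-- The matrix describing the left action of `φ!` on the column of `φ` and `1_B`. -/
def cornerMatrix (φ : A →ₐ[F] B) : Bool → Bool → MapAlg φ →ₗ[F] MapAlg φ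
  | false, false => inB φ ∘ₗ φ.toLinearMap ∘ₗ prA φ
  | false, true => 0
  | true, false => inB φ ∘ₗ prD φ
  | true, true => inB φ ∘ₗ prB φ

/-- The column of `φ` and `1_B`. -/
def cornerColumn (φ : A →ₐ[F] B) : Bool → MapAlg φ
  | false => eφ φ
  | true => eB φ

/-- The matrix is triangular with multiplicative diagonal entries φ(a) and b₁. Its off-diagonal
entry b₂ is a derivation relative to them. -/
lemma cornerMatrix_mul (i k : Bool) (a b : MapAlg φ) :
    cornerMatrix φ i k (a * b) = ∑ j, cornerMatrix φ i j a * cornerMatrix φ j k b := by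
  cases i <;> cases k <;> ext <;> simp [cornerMatrix]
  abel

lemma cornerColumn_mul (i : Bool) (a : MapAlg φ) :
    cornerColumn φ i * a = ∑ j, cornerMatrix φ i j a * cornerColumn φ j := by
  cases i <;> ext <;> simp [cornerMatrix, cornerColumn, eφ, eB]

lemma cornerL_eB (T : Bimod F B N) : cornerL φ T (eB φ) = LinearMap.id :=
  LinearMap.ext fun m => T.one_lact m

lemma cornerL_eφ (T : Bimod F B N) : cornerL φ T (eφ φ) = 0 :=
  LinearMap.ext fun m => T.zero_lact m

/-- The right action on Nφ factors through A, and neither φ nor 1_B has a component there. This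
removes the right outer term from the homotopy formula. -/
lemma cornerR_cornerColumn (T : Bimod F B N) (i : Bool) :
    cornerR φ T (cornerColumn φ i) = 0 := by
  refine LinearMap.ext fun m => ?_
  cases i <;> simp [cornerR_apply, cornerColumn, eφ, eB]

/-- The insertion of the column of `φ` and `1_B`. -/
def cornerInsertion (φ : A →ₐ[F] B) (N : Type y) [AddCommGroup N] [Module F N] (n : ℕ) (i : Bool) :
    HC F (MapAlg φ) N (n + 1) →ₗ[F] HC F (MapAlg φ) N n :=
  insertion LinearMap.id (cornerMatrix φ) (cornerColumn φ) n i

lemma cornerInsertion_hoch_zero (T : Bimod F B N) (f : HC F (MapAlg φ) N 0) :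
    cornerInsertion φ N 0 true (hoch (cornerL φ T) (cornerR φ T) 0 f) = f := by
  rw [cornerInsertion, insertion_hoch_zero, columnMul_eq_zero (cornerR_cornerColumn T), sub_zero,
    pull_id]
  exact (congrArg (fun k => postComp k 0 f) (cornerL_eB T)).trans (postComp_id 0 f)

lemma cornerInsertion_hoch_succ (T : Bimod F B N) (n : ℕ) (i : Bool)
    (f : HC F (MapAlg φ) N (n + 1)) :
    cornerInsertion φ N (n + 1) i (hoch (cornerL φ T) (cornerR φ T) (n + 1) f) =
      postComp (cornerL φ T (cornerColumn φ i)) (n + 1) f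
        - (leading (cornerL φ T ∘ₗ cornerMatrix φ i true) n (cornerInsertion φ N n true f)
          + leading (cornerL φ T ∘ₗ cornerMatrix φ i false) n (cornerInsertion φ N n false f))
        - trailing (cornerR φ T) n (cornerInsertion φ N n i f) := by
  have key := insertion_hoch_succ (θ := LinearMap.id) (Θ := cornerMatrix φ) (e := cornerColumn φ)
    (fun _ _ => rfl) cornerMatrix_mul cornerColumn_mul (cornerL φ T) (cornerR φ T) n i f
  rw [columnMul_eq_zero (cornerR_cornerColumn T), sub_zero, Fintype.sum_bool] at key
  exact key

/-- Without the cup product this would be a contracting homotopy. That term comes from the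
off-diagonal entry b₂ in 1_B·x = b₁·1_B + b₂·φ. -/
lemma cornerInsertion_true_hoch (T : Bimod F B N) (n : ℕ) (f : HC F (MapAlg φ) N (n + 1)) :
    cornerInsertion φ N (n + 1) true (hoch (cornerL φ T) (cornerR φ T) (n + 1) f) =
      f - leading (actD T) n (cornerInsertion φ N n false f)
        - hoch (cornerL φ T) (cornerR φ T) n (cornerInsertion φ N n true f) := by
  rw [cornerInsertion_hoch_succ, cornerColumn, cornerL_eB, postComp_id, hoch_apply]
  change f - (leading (cornerL φ T) n _ + leading (actD T) n _) - _ = _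
  abel

/-- The left outer term disappears because φ acts on the corner by zero. Moving arguments past φ
turns the left action on Nφ into the action through φ and A, so the insertion of φ anticommutes with
the differentials. -/
lemma cornerInsertion_false_hoch (T : Bimod F B N) (n : ℕ) (f : HC F (MapAlg φ) N (n + 1)) :
    cornerInsertion φ N (n + 1) false (hoch (cornerL φ T) (cornerR φ T) (n + 1) f) =
      -hoch ((T.restrict φ).leftL ∘ₗ prA φ) ((T.restrict φ).rightL ∘ₗ prA φ) n
        (cornerInsertion φ N n false f) := by
  have h : leading (cornerL φ T ∘ₗ cornerMatrix φ false true) n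
      (cornerInsertion φ N n true f) = 0 := by
    refine slice_ext fun a => ?_
    rw [slice_leading, cornerMatrix, LinearMap.comp_zero]
    rfl
  rw [cornerInsertion_hoch_succ, cornerColumn, cornerL_eφ, postComp_zero, h, hoch_apply]
  change 0 - (0 + leading ((T.restrict φ).leftL ∘ₗ prA φ) n _)
    - trailing ((T.restrict φ).rightL ∘ₗ prA φ) n _ = _
  abel

/-- A cocycle of `φ!` with coefficients in the corner `Nφ` that is killed by the insertion of `φ` is
a coboundary. -/
lemma exists_primitive_corner (T : Bimod F B N) (n : ℕ) (f : HC F (MapAlg φ) N n)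
    (hf : hoch (cornerL φ T) (cornerR φ T) n f = 0)
    (h : insertShift (inA φ) (inB φ ∘ₗ φ.toLinearMap) (eφ φ) n f = 0) :
    ∃ k : Shift (HC F (MapAlg φ) N) n, shiftD (hoch (cornerL φ T) (cornerR φ T)) n k = f := by
  cases n with
  | zero =>
    refine ⟨0, ?_⟩
    rw [← cornerInsertion_hoch_zero T f, hf, map_zero, map_zero]
  | succ n =>
    have h0 := cornerInsertion_false_hoch T n f
    have h1 := cornerInsertion_true_hoch T n f
    rw [hf, map_zero] at h0 h1
    -- The row of φ is diagonal, so this component inserts φ alone. On arguments from A it is the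
    -- insertion assumed to vanish.
    have hr : pull (inA φ) n (cornerInsertion φ N n false f) = 0 := by
      refine Eq.trans ?_ h
      rw [cornerInsertion,
        insertion_eq_of_row (i := false) (by intro j hj; cases j <;> simp_all [cornerMatrix])]
      exact pull_insertion _ _ _ _ n () f
    obtain ⟨j, hj, -⟩ := exists_primitive_prA (T.restrict φ) n _ (neg_eq_zero.1 h0.symm) hr
    -- A primitive j of the insertion of φ gives, by the cup product with D, a primitive of the
    -- obstructing cup product up to sign.
    have hj' : hoch (cornerL φ T) (cornerR φ T) n (shiftD (leading (actD T)) n j) =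
        -leading (actD T) n (cornerInsertion φ N n false f) := by
      rw [← hj]
      cases n with
      | zero =>
        change hoch _ _ 0 0 = -leading _ 0 0
        rw [map_zero, map_zero, neg_zero]
      | succ n => exact hoch_corner_leading T n j
    refine ⟨cornerInsertion φ N n true f - shiftD (leading (actD T)) n j, ?_⟩
    refine (map_sub (hoch (cornerL φ T) (cornerR φ T) n) _ _).trans ?_
    rw [hj', sub_neg_eq_add, ← sub_eq_zero, ← neg_eq_zero, h1]
    abel

end MappingAlgebra

/-! ### The comparison of Hochschild complexes: cochain map, surjectivity, acyclic kernel. -/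

section Comparison

open MapAlg

variable {F : Type u} [Field F] {A : Type v} [Ring A] [Algebra F A]
  {B : Type w} [Ring B] [Algebra F B] {M : Type x} [AddCommGroup M] [Module F M]
  {N : Type y} [AddCommGroup N] [Module F N]

/-- The bimodule `X` over `φ!` is the bimodule `ψ!`. -/
structure IsMapBimod (φ : A →ₐ[F] B) (S : Bimod F A M) (T : Bimod F B N) (ψ : M →ₗ[F] N)
    (X : Bimod F (MapAlg φ) (M × N × N)) : Prop where
  lact : ∀ x m, X.lact x m =
    (S.lact x.1 m.1, T.lact x.2.1 m.2.1, T.lact x.2.2 (ψ m.1) + T.lact x.2.1 m.2.2)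
  ract : ∀ m x, X.ract m x =
    (S.ract m.1 x.1, T.ract m.2.1 x.2.1, T.ract m.2.2 (φ x.1) + T.ract m.2.1 x.2.2)

/-- The projection to the second of three components. -/
def prMid (F : Type u) [Field F] (M : Type x) [AddCommGroup M] [Module F M]
    (N : Type y) [AddCommGroup N] [Module F N] : M × N × N →ₗ[F] N :=
  LinearMap.fst F N N ∘ₗ LinearMap.snd F M (N × N)

/-- The projection to the third of three components. -/
def prTrd (F : Type u) [Field F] (M : Type x) [AddCommGroup M] [Module F M]
    (N : Type y) [AddCommGroup N] [Module F N] : M × N × N →ₗ[F] N :=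
  LinearMap.snd F N N ∘ₗ LinearMap.snd F M (N × N)

/-- The inclusion of the second of three components. -/
def inMid (F : Type u) [Field F] (M : Type x) [AddCommGroup M] [Module F M]
    (N : Type y) [AddCommGroup N] [Module F N] : N →ₗ[F] M × N × N :=
  LinearMap.inr F M (N × N) ∘ₗ LinearMap.inl F N N

/-- The inclusion of the third of three components. -/
def inTrd (F : Type u) [Field F] (M : Type x) [AddCommGroup M] [Module F M]
    (N : Type y) [AddCommGroup N] [Module F N] : N →ₗ[F] M × N × N :=
  LinearMap.inr F M (N × N) ∘ₗ LinearMap.inr F N N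

/-- The insertion of the element `φ` of `φ!`. -/
def insertφ (φ : A →ₐ[F] B) (n : ℕ) : HC F (MapAlg φ) N n →ₗ[F] Shift (HC F A N) n :=
  insertShift (inA φ) (inB φ ∘ₗ φ.toLinearMap) (eφ φ) n

/-- The comparison map from the Hochschild cochains of `φ!` to the cochains of `φ`. -/
def comparison (φ : A →ₐ[F] B) (n : ℕ) :
    HC F (MapAlg φ) (M × N × N) n →ₗ[F] CPhi F A B M N n :=
  LinearMap.prod (pull (inA φ) n ∘ₗ postComp (LinearMap.fst F M (N × N)) n)
    (LinearMap.prod (pull (inB φ) n ∘ₗ postComp (prMid F M N) n)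
      (insertφ φ n ∘ₗ postComp (prTrd F M N) n))

lemma comparison_apply (φ : A →ₐ[F] B) (n : ℕ) (f : HC F (MapAlg φ) (M × N × N) n) :
    comparison φ n f = (pull (inA φ) n (postComp (LinearMap.fst F M (N × N)) n f),
      pull (inB φ) n (postComp (prMid F M N) n f), insertφ φ n (postComp (prTrd F M N) n f)) := rfl

lemma dPhi_apply (φ : A →ₐ[F] B) (S : Bimod F A M) (T : Bimod F B N) (ψ : M →ₗ[F] N) (n : ℕ)
    (f : HC F A M n) (g : HC F B N n) (h : Shift (HC F A N) n) :
    dPhi φ S T ψ n (f, g, h) = (dAlg S n f, dAlg T n g,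
      postComp ψ n f - preComp φ n g - shiftD (dAlg (T.restrict φ)) n h) := rfl

variable {φ : A →ₐ[F] B} {S : Bimod F A M} {T : Bimod F B N} {ψ : M →ₗ[F] N}
  {X : Bimod F (MapAlg φ) (M × N × N)}

lemma restrict_lact (T : Bimod F B N) (φ : A →ₐ[F] B) (a : A) (m : N) :
    (T.restrict φ).lact a m = T.lact (φ a) m := rfl

lemma restrict_ract (T : Bimod F B N) (φ : A →ₐ[F] B) (a : A) (m : N) :
    (T.restrict φ).ract m a = T.ract m (φ a) := rfl

lemma dAlg_eq (S : Bimod F A M) : dAlg S = hoch S.leftL S.rightL := funext (dAlg_eq_hoch S)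

lemma insertφ_postComp {K : Type*} [AddCommGroup K] [Module F K] (g : K →ₗ[F] N) (n : ℕ)
    (f : HC F (MapAlg φ) K n) :
    insertφ φ n (postComp g n f) = shiftMap (postComp g) n (insertφ φ n f) := by
  cases n with
  | zero => rfl
  | succ n => exact insertion_postComp _ _ _ g n () f

lemma comparison_dAlg (hX : IsMapBimod φ S T ψ X) (n : ℕ)
    (f : HC F (MapAlg φ) (M × N × N) n) :
    comparison φ (n + 1) (dAlg X n f) = dPhi φ S T ψ n (comparison φ n f) := by
  rw [comparison_apply, comparison_apply, dPhi_apply]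
  refine Prod.ext ?_ (Prod.ext ?_ ?_)
  · change pull _ _ (postComp _ _ _) = dAlg S n _
    rw [dAlg_eq, dAlg_eq, postComp_hoch (l' := S.leftL ∘ₗ prA φ) (r' := S.rightL ∘ₗ prA φ)
      (fun a m => by simp [Bimod.leftL_apply, hX.lact])
      (fun a m => by simp [Bimod.rightL_apply, hX.ract]), pull_hoch inA_mul]
    rfl
  · change pull _ _ (postComp _ _ _) = dAlg T n _
    rw [dAlg_eq, dAlg_eq, postComp_hoch (l' := T.leftL ∘ₗ prB φ) (r' := T.rightL ∘ₗ prB φ)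
      (fun a m => by simp [Bimod.leftL_apply, hX.lact, prMid])
      (fun a m => by simp [Bimod.rightL_apply, hX.ract, prMid]), pull_hoch inB_mul]
    rfl
  · change insertφ φ (n + 1) (postComp _ _ _) = postComp ψ n _ - preComp φ n _ - _
    -- In the third component, left multiplication by φ carries the M-part to its image under ψ, and
    -- right multiplication by φ carries the N-part to the corner.
    have key := insertShift_hoch (θ := inA φ) (θ' := inB φ ∘ₗ φ.toLinearMap) (e := eφ φ) inA_mul
      (fun a b => by ext <;> simp) (fun a => by ext <;> simp [eφ]) X.leftL X.rightL n f
    rw [dAlg_eq, dAlg_eq]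
    refine (insertion_postComp _ _ _ (prTrd F M N) n () _).trans ?_
    refine (congrArg (postComp (prTrd F M N) n) (key.trans (sub_right_comm _ _ _))).trans ?_
    rw [map_sub, map_sub]
    congr 1
    · congr 1
      · rw [postComp_postComp, pull_postComp, postComp_postComp]
        refine congrArg (fun k => postComp k n _) (LinearMap.ext fun m => ?_)
        simp [prTrd, Bimod.leftL_apply, hX.lact, eφ]
      · rw [postComp_postComp]
        have : prTrd F M N ∘ₗ X.rightL (eφ φ) = prMid F M N := by
          refine LinearMap.ext fun m => ?_
          simp [prTrd, prMid, Bimod.rightL_apply, hX.ract, eφ]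
        rw [this]
        rfl
    · rw [insertφ_postComp]
      cases n with
      | zero => exact map_zero _
      | succ n =>
        exact postComp_hoch (l' := (T.restrict φ).leftL) (r' := (T.restrict φ).rightL)
          (fun a m => by simp [Bimod.leftL_apply, hX.lact, prTrd, restrict_lact])
          (fun a m => by simp [Bimod.rightL_apply, hX.ract, prTrd, restrict_ract])
          n _

/-- The cup product of a cochain on `A` with the coefficient of `φ`. -/
def cupD (φ : A →ₐ[F] B) (T : Bimod F B N) :
    ∀ n, Shift (HC F A N) n →ₗ[F] HC F (MapAlg φ) N n
  | 0 => 0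
  | n + 1 => leading (actD T) n ∘ₗ pull (prA φ) n

/-- The derivation D is 1 on φ and 0 on B. Of all insertion positions only the first one
contributes. -/
lemma insertφ_cupD (T : Bimod F B N) (n : ℕ) (h : Shift (HC F A N) n) :
    insertφ φ n (cupD φ T n h) = h := by
  have hD : actD T (eφ φ) = LinearMap.id := LinearMap.ext fun m => T.one_lact m
  cases n with
  | zero => rfl
  | succ n =>
    refine (?_ : insertion _ _ _ n () (leading (actD T) n (pull (prA φ) n h)) = h)
    cases n with
    | zero =>
      rw [insertion_leading_zero]
      exact congrArg (fun k => postComp k 0 (pull (inA φ) 0 (pull (prA φ) 0 h))) hD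
    | succ n =>
      rw [insertion_leading_succ, Fintype.sum_unique]
      have h0 : actD T ∘ₗ inB φ ∘ₗ φ.toLinearMap = 0 :=
        LinearMap.ext fun a => LinearMap.ext fun m => T.zero_lact m
      rw [h0, hD]
      refine slice_ext fun a => ?_
      rw [map_sub, LinearMap.sub_apply, slice_leading]
      exact sub_zero _

lemma hoch_cupD (T : Bimod F B N) (n : ℕ) (h : Shift (HC F A N) n) :
    hoch (cornerL φ T) (cornerR φ T) n (cupD φ T n h) =
      -leading (actD T) n (pull (prA φ) n (shiftD (dAlg (T.restrict φ)) n h)) := by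
  cases n with
  | zero =>
    change hoch _ _ 0 0 = -leading _ 0 (pull _ 0 0)
    rw [map_zero, map_zero, map_zero, neg_zero]
  | succ n =>
    change HC F A N n at h
    refine (hoch_corner_leading T n (pull (prA φ) n h)).trans ?_
    rw [← pull_hoch (θ := prA φ) prA_mul, ← dAlg_eq]
    rfl

lemma dAlg_inTrd (hX : IsMapBimod φ S T ψ X) (n : ℕ) (f : HC F (MapAlg φ) N n) :
    dAlg X n (postComp (inTrd F M N) n f) =
      postComp (inTrd F M N) (n + 1) (hoch (cornerL φ T) (cornerR φ T) n f) := by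
  rw [dAlg_eq, postComp_hoch]
  · intro a m
    simp [Bimod.leftL_apply, hX.lact, inTrd, cornerL_apply]
  · intro a m
    simp [Bimod.rightL_apply, hX.ract, inTrd, cornerR_apply]

lemma comparison_inTrd (n : ℕ) (f : HC F (MapAlg φ) N n) :
    comparison (M := M) φ n (postComp (inTrd F M N) n f) = (0, 0, insertφ φ n f) := rfl

lemma comparison_inl (n : ℕ) (f : HC F (MapAlg φ) M n) :
    comparison (N := N) φ n (postComp (LinearMap.inl F M (N × N)) n f) =
      (pull (inA φ) n f, 0, 0) := by
  refine Prod.ext rfl (Prod.ext rfl ?_)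
  exact map_zero (insertφ φ n)

lemma comparison_inMid (n : ℕ) (f : HC F (MapAlg φ) N n) :
    comparison (M := M) φ n (postComp (inMid F M N) n f) = (0, pull (inB φ) n f, 0) := by
  refine Prod.ext rfl (Prod.ext rfl ?_)
  exact map_zero (insertφ φ n)

lemma comparison_surjective (φ : A →ₐ[F] B) (T : Bimod F B N) (n : ℕ) :
    Function.Surjective (comparison (F := F) (M := M) (N := N) φ n) := by
  rintro ⟨f, g, h⟩
  refine ⟨postComp (LinearMap.inl F M (N × N)) n (pull (prA φ) n f)
    + postComp (inMid F M N) n (pull (prB φ) n g)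
    + postComp (inTrd F M N) n (cupD φ T n h), ?_⟩
  rw [map_add, map_add, comparison_inl, comparison_inMid, comparison_inTrd, insertφ_cupD]
  simp [pull_pull, pull_id]

lemma fst_dAlg (hX : IsMapBimod φ S T ψ X) (n : ℕ) (f : HC F (MapAlg φ) (M × N × N) n) :
    postComp (LinearMap.fst F M (N × N)) (n + 1) (dAlg X n f) =
      hoch (S.leftL ∘ₗ prA φ) (S.rightL ∘ₗ prA φ) n (postComp (LinearMap.fst F M (N × N)) n f) := by
  rw [dAlg_eq, postComp_hoch]
  · intro a m
    simp [Bimod.leftL_apply, hX.lact]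
  · intro a m
    simp [Bimod.rightL_apply, hX.ract]

lemma mid_dAlg (hX : IsMapBimod φ S T ψ X) (n : ℕ) (f : HC F (MapAlg φ) (M × N × N) n) :
    postComp (prMid F M N) (n + 1) (dAlg X n f) =
      hoch (T.leftL ∘ₗ prB φ) (T.rightL ∘ₗ prB φ) n (postComp (prMid F M N) n f) := by
  rw [dAlg_eq, postComp_hoch]
  · intro a m
    simp [Bimod.leftL_apply, hX.lact, prMid]
  · intro a m
    simp [Bimod.rightL_apply, hX.ract, prMid]

lemma eq_inTrd {n : ℕ} {f : HC F (MapAlg φ) (M × N × N) n}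
    (h1 : postComp (LinearMap.fst F M (N × N)) n f = 0) (h2 : postComp (prMid F M N) n f = 0) :
    f = postComp (inTrd F M N) n (postComp (prTrd F M N) n f) := by
  ext v : 1
  exact Prod.ext (congrArg (fun k => k v) h1) (Prod.ext (congrArg (fun k => k v) h2) rfl)

lemma postComp_inTrd_injective (n : ℕ) : Function.Injective
    (postComp (inTrd F M N) n : HC F (MapAlg φ) N n →ₗ[F] HC F (MapAlg φ) (M × N × N) n) :=
  fun _ _ h => congrArg (postComp (prTrd F M N) n) h

/-- Cocycles in the kernel of the comparison map with vanishing first two components are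
coboundaries. -/
lemma exists_primitive_inTrd (hX : IsMapBimod φ S T ψ X) (n : ℕ)
    (f : HC F (MapAlg φ) (M × N × N) n) (hf : dAlg X n f = 0) (h : comparison φ n f = 0)
    (h1 : postComp (LinearMap.fst F M (N × N)) n f = 0) (h2 : postComp (prMid F M N) n f = 0) :
    ∃ k : Shift (HC F (MapAlg φ) N) n,
      shiftD (hoch (cornerL φ T) (cornerR φ T)) n k = postComp (prTrd F M N) n f := by
  refine exists_primitive_corner T n _ ?_ ?_
  · apply postComp_inTrd_injective (M := M)
    rw [← dAlg_inTrd hX, ← eq_inTrd h1 h2, hf, map_zero]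
  · exact congrArg (fun k => k.2.2) h

/-- The kernel of the comparison map is acyclic. -/
lemma exists_primitive_ker_comparison (hX : IsMapBimod φ S T ψ X) (n : ℕ)
    (f : HC F (MapAlg φ) (M × N × N) n) (hf : dAlg X n f = 0) (h : comparison φ n f = 0) :
    ∃ k : Shift (HC F (MapAlg φ) (M × N × N)) n,
      shiftD (dAlg X) n k = f ∧ shiftMap (comparison φ) n k = 0 := by
  obtain ⟨k₁, hk₁, hk₁'⟩ := exists_primitive_prA S n (postComp (LinearMap.fst F M (N × N)) n f)
    (by rw [← fst_dAlg hX, hf, map_zero]) (congrArg (fun k => k.1) h)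
  obtain ⟨k₂, hk₂, hk₂'⟩ := exists_primitive_prB T n (postComp (prMid F M N) n f)
    (by rw [← mid_dAlg hX, hf, map_zero]) (congrArg (fun k => k.2.1) h)
  cases n with
  | zero =>
    obtain ⟨k₃, hk₃⟩ := exists_primitive_inTrd hX 0 f hf h hk₁.symm hk₂.symm
    refine ⟨0, ?_, rfl⟩
    rw [eq_inTrd hk₁.symm hk₂.symm, ← hk₃]
    exact (map_zero (postComp (inTrd F M N) 0)).symm
  | succ n =>
    change HC F (MapAlg φ) M n at k₁
    change HC F (MapAlg φ) N n at k₂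
    change hoch _ _ n k₁ = _ at hk₁
    change hoch _ _ n k₂ = _ at hk₂
    change pull _ n k₁ = 0 at hk₁'
    change pull _ n k₂ = 0 at hk₂'
    -- Subtracting the coboundary of g leaves a cocycle with values in Nφ. As g has no corner
    -- component and vanishes on A and B, it stays in the kernel.
    set g := postComp (LinearMap.inl F M (N × N)) n k₁ + postComp (inMid F M N) n k₂ with hg
    have hg0 : comparison φ n g = 0 := by
      rw [hg, map_add, comparison_inl, comparison_inMid, hk₁', hk₂']
      simp
    have hc : comparison φ (n + 1) (f - dAlg X n g) = 0 := by
      rw [map_sub, h, comparison_dAlg hX, hg0, map_zero, sub_zero]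
    have hg1 : postComp (LinearMap.fst F M (N × N)) n g = k₁ := by
      ext v
      simp [hg, postComp_apply, inMid]
    have hg2 : postComp (prMid F M N) n g = k₂ := by
      ext v
      simp [hg, postComp_apply, inMid, prMid]
    have h1 : postComp (LinearMap.fst F M (N × N)) (n + 1) (f - dAlg X n g) = 0 := by
      rw [map_sub, fst_dAlg hX, hg1, hk₁, sub_self]
    have h2 : postComp (prMid F M N) (n + 1) (f - dAlg X n g) = 0 := by
      rw [map_sub, mid_dAlg hX, hg2, hk₂, sub_self]
    obtain ⟨k₃, hk₃⟩ := exists_primitive_inTrd hX (n + 1) (f - dAlg X n g)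
      (by rw [map_sub, hf, dAlg_dAlg, sub_self]) hc h1 h2
    change HC F (MapAlg φ) N n at k₃
    change hoch _ _ n k₃ = _ at hk₃
    have hk₃' : dAlg X n (postComp (inTrd F M N) n k₃) = f - dAlg X n g := by
      rw [dAlg_inTrd hX, hk₃, ← eq_inTrd h1 h2]
    -- The corner primitive need not lie in the kernel, but the defect is a cocycle on A.
    have hu : shiftD (dAlg (T.restrict φ)) n (insertφ φ n k₃) = 0 := by
      have := comparison_dAlg hX n (postComp (inTrd F M N) n k₃)
      rw [hk₃', hc, comparison_inTrd, dPhi_apply] at this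
      have := (congrArg (fun k => k.2.2) this).symm
      simp only [map_zero, sub_zero, zero_sub] at this
      exact neg_eq_zero.1 this
    -- The cup product of D with the defect is a cocycle having the same insertion, so subtracting
    -- it repairs the primitive without changing its coboundary.
    refine ⟨g + postComp (inTrd F M N) n (k₃ - cupD φ T n (insertφ φ n k₃)), ?_, ?_⟩
    · change dAlg X n _ = f
      rw [map_add, map_sub, map_sub, hk₃', dAlg_inTrd hX n (cupD φ T n _), hoch_cupD, hu, map_zero,
        map_zero, neg_zero, map_zero, sub_zero, add_sub_cancel]
    · change comparison φ n _ = 0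
      rw [map_add, hg0, comparison_inTrd, map_sub, insertφ_cupD, sub_self, zero_add]
      rfl

end Comparison

/-! ### Surjective cochain maps with acyclic kernel. -/

section Cone

variable {F : Type u} [Field F]

/-- A surjective cochain map with acyclic kernel induces isomorphisms in cohomology. -/
lemma nonempty_cohomology_equiv {X : ℕ → Type v} [∀ n, AddCommGroup (X n)] [∀ n, Module F (X n)]
    {Y : ℕ → Type w} [∀ n, AddCommGroup (Y n)] [∀ n, Module F (Y n)]
    {d : ∀ n, X n →ₗ[F] X (n + 1)} {d' : ∀ n, Y n →ₗ[F] Y (n + 1)} {ρ : ∀ n, X n →ₗ[F] Y n}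
    (hd : ∀ n x, d (n + 1) (d n x) = 0) (hρ : ∀ n x, ρ (n + 1) (d n x) = d' n (ρ n x))
    (hs : ∀ n, Function.Surjective (ρ n))
    (hk : ∀ n x, d n x = 0 → ρ n x = 0 → ∃ k, shiftD d n k = x ∧ shiftMap ρ n k = 0) (n : ℕ) :
    Nonempty (Cohomology d' n ≃ₗ[F] Cohomology d n) := by
  have hsh : ∀ n k, ρ n (shiftD d n k) = shiftD d' n (shiftMap ρ n k) := by
    rintro (_ | n) k
    · exact map_zero _
    · exact hρ n k
  have hdsh : ∀ n k, d n (shiftD d n k) = 0 := by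
    rintro (_ | n) k
    · exact map_zero _
    · exact hd n k
  have hssh : ∀ n, Function.Surjective (shiftMap ρ n) := by
    rintro (_ | n)
    · exact fun _ => ⟨PUnit.unit, rfl⟩
    · exact hs n
  let r : LinearMap.ker (d n) →ₗ[F] LinearMap.ker (d' n) :=
    (ρ n).restrict fun x hx => by
      rw [LinearMap.mem_ker] at hx ⊢
      rw [← hρ, hx, map_zero]
  let q := ((LinearMap.range (shiftD d' n)).submoduleOf (LinearMap.ker (d' n))).mkQ ∘ₗ r
  have hq : Function.Surjective q := by
    refine (Submodule.mkQ_surjective _).comp ?_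
    rintro ⟨y, hy⟩
    obtain ⟨x, rfl⟩ := hs n y
    have h0 : ρ (n + 1) (d n x) = 0 := by rw [hρ]; exact hy
    -- A lift x of a cocycle need not be closed. Its coboundary is a cocycle in the kernel one
    -- degree up, and a primitive inside the kernel corrects x without changing its image.
    obtain ⟨k, hk₁, hk₂⟩ := hk (n + 1) (d n x) (hd n x) h0
    change X n at k
    change d n k = _ at hk₁
    change ρ n k = 0 at hk₂
    refine ⟨⟨x - k, ?_⟩, Subtype.ext ?_⟩
    · rw [LinearMap.mem_ker]
      exact (map_sub (d n) x k).trans (sub_eq_zero.2 hk₁.symm)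
    · exact (map_sub (ρ n) x k).trans ((congrArg (ρ n x - ·) hk₂).trans (sub_zero _))
  have hker : LinearMap.ker q =
      (LinearMap.range (shiftD d n)).submoduleOf (LinearMap.ker (d n)) := by
    ext ⟨x, hx⟩
    rw [LinearMap.mem_ker]
    change Submodule.Quotient.mk (r ⟨x, hx⟩) = 0 ↔ x ∈ LinearMap.range (shiftD d n)
    rw [Submodule.Quotient.mk_eq_zero]
    change ρ n x ∈ LinearMap.range (shiftD d' n) ↔ _
    constructor
    · rintro ⟨y, hy⟩
      obtain ⟨z, rfl⟩ := hssh n y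
      obtain ⟨k, hk₁, -⟩ := hk n (x - shiftD d n z)
        (by rw [map_sub, hdsh, sub_zero]; exact hx) (by rw [map_sub, hsh, hy, sub_self])
      exact ⟨z + k, by rw [map_add, hk₁, add_sub_cancel]⟩
    · rintro ⟨k, rfl⟩
      exact ⟨shiftMap ρ n k, (hsh n k).symm⟩
  exact ⟨((Submodule.quotEquivOfEq _ _ hker.symm).trans
    (q.quotKerEquivOfSurjective hq)).symm⟩

end Cone

/-! ### The comparison of the complexes with differential operators. -/

section Comparison

open MapAlg

variable {F : Type u} [Field F] {lam : F} {A : Type v} [Ring A] [Algebra F A]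
  {B : Type w} [Ring B] [Algebra F B] {M : Type x} [AddCommGroup M] [Module F M]
  {N : Type y} [AddCommGroup N] [Module F N] {dA : DiffOp F lam A} {dB : DiffOp F lam B}
  (φ : DiffHom dA dB) {S : DiffBimod dA M} {T : DiffBimod dB N}
  (ψ : DiffBimodHom S (T.restrict φ))

lemma isMapBimod_mapBimod :
    IsMapBimod φ.hom S.toBimod T.toBimod ψ.hom (mapDiffBimod φ ψ).toBimod :=
  ⟨fun _ _ => rfl, fun _ _ => rfl⟩

/-- The morphism φ commutes with the twists id + lam d. Twisting therefore commutes with forming the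
mapping bimodule, and the Hochschild results apply to both kinds of coefficients. -/
lemma isMapBimod_tri : IsMapBimod φ.hom S.tri T.tri ψ.hom (mapDiffBimod φ ψ).tri :=
  ⟨fun _ _ => rfl, fun m x => by
    have h : φ.hom (dA.twist x.1) = dB.twist (φ.hom x.1) := by
      change φ.hom (x.1 + lam • dA.d x.1) = φ.hom x.1 + lam • dB.d (φ.hom x.1)
      rw [map_add, map_smul, φ.comm]
    refine Prod.ext rfl (Prod.ext rfl ?_)
    change T.ract m.2.2 (φ.hom (dA.twist x.1)) + _ = T.ract m.2.2 (dB.twist (φ.hom x.1)) + _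
    rw [h]
    rfl⟩

/-- In the third component Φ loses one argument. This is harmless because d_B(1) = 0 means that the
operator kills the inserted φ. -/
lemma comparison_bigPhi (n : ℕ) (f : HC F (MapAlg φ.hom) (M × N × N) n) :
    comparison φ.hom n (bigPhi (mapDiffBimod φ ψ) n f) =
      piMap φ S T n (comparison φ.hom n f) := by
  rw [bigPhi_eq_phi]
  refine Prod.ext ?_ (Prod.ext ?_ ?_)
  · change pull _ n (postComp _ n _) = bigPhi S n (pull _ n (postComp _ n f))
    rw [bigPhi_eq_phi, postComp_phi (g := LinearMap.fst F M (N × N)) (e := (mapDiffBimod φ ψ).d)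
      (e' := S.d) fun _ => rfl]
    exact pull_phi (fun a => by ext <;> simp [mapAlgDiff_d]) _ _ _
  · change pull _ n (postComp _ n _) = bigPhi T n (pull _ n (postComp _ n f))
    rw [bigPhi_eq_phi, postComp_phi (g := prMid F M N) (e := (mapDiffBimod φ ψ).d)
      (e' := T.d) fun _ => rfl]
    exact pull_phi (fun a => by ext <;> simp [mapAlgDiff_d]) _ _ _
  · change insertφ φ.hom n (postComp _ n _) =
      shiftMap (bigPhi (T.restrict φ)) n (insertφ φ.hom n (postComp _ n f))
    rw [postComp_phi (g := prTrd F M N) (e := (mapDiffBimod φ ψ).d)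
      (e' := T.d) fun _ => rfl]
    cases n with
    | zero => rfl
    | succ n =>
      rw [show bigPhi (T.restrict φ) = fun n => phi lam dA.d T.d n from
        funext (bigPhi_eq_phi (T.restrict φ))]
      exact insertion_phi (fun a => by ext <;> simp [mapAlgDiff_d])
        (fun _ _ a => by ext <;> simp [mapAlgDiff_d, φ.comm])
        (fun _ => by ext <;> simp [mapAlgDiff_d, eφ, dB.d_one]) T.d n () _

/-- The comparison map from the complex of the differential algebra `φ!` to the complex of the
morphism `φ`. -/
def comparisonDA (φ : DiffHom dA dB) (n : ℕ) :
    CDA F (MapAlg φ.hom) (M × N × N) n →ₗ[F] CMor F A B M N n :=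
  -- The sign reconciles the two conventions: (-1)^{n+1}(-∂_▷ g - Φ f) = ∂_▷((-1)^n g) + (-1)^n Φ f.
  LinearMap.prodMap (comparison φ.hom n) ((-1 : F) ^ n • shiftMap (comparison φ.hom) n)

lemma dDA_apply (n : ℕ) (f : HC F A M n) (g : Shift (HC F A M) n) :
    dDA S n (f, g) = (dAlg S.toBimod n f, -shiftD (dAlg S.tri) n g - bigPhi S n f) := rfl

lemma dDA_dDA (n : ℕ) (z : CDA F A M n) : dDA S (n + 1) (dDA S n z) = 0 := by
  obtain ⟨f, g⟩ := z
  have h : dAlg S.tri n (shiftD (dAlg S.tri) n g) = 0 := by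
    cases n with
    | zero => exact map_zero _
    | succ n => exact dAlg_dAlg S.tri n g
  rw [dDA_apply, dDA_apply, dAlg_dAlg]
  refine Prod.ext rfl ?_
  change -dAlg S.tri n (-shiftD (dAlg S.tri) n g - bigPhi S n f) - bigPhi S (n + 1) _ = 0
  rw [bigPhi_dAlg, map_sub, map_neg, h]
  abel

lemma comparisonDA_dDA (n : ℕ) (z : CDA F (MapAlg φ.hom) (M × N × N) n) :
    comparisonDA φ (n + 1) (dDA (mapDiffBimod φ ψ) n z) =
      dMor φ ψ n (comparisonDA φ n z) := by
  obtain ⟨f, g⟩ := z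
  refine Prod.ext (comparison_dAlg (isMapBimod_mapBimod φ ψ) n f) ?_
  have h : comparison φ.hom n (shiftD (dAlg (mapDiffBimod φ ψ).tri) n g) =
      shiftD (dPhi φ.hom S.tri T.tri ψ.hom) n (shiftMap (comparison φ.hom) n g) := by
    cases n with
    | zero => exact map_zero _
    | succ n => exact comparison_dAlg (isMapBimod_tri φ ψ) n g
  change (-1 : F) ^ (n + 1) • comparison φ.hom n
      (-shiftD (dAlg (mapDiffBimod φ ψ).tri) n g - bigPhi (mapDiffBimod φ ψ) n f) =
    shiftD (dPhi φ.hom S.tri T.tri ψ.hom) n ((-1 : F) ^ n • shiftMap (comparison φ.hom) n g)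
      + (-1 : F) ^ n • piMap φ S T n (comparison φ.hom n f)
  rw [map_sub, map_neg, h, comparison_bigPhi, map_smul, pow_succ, mul_neg_one, neg_smul, smul_sub,
    smul_neg]
  abel

lemma comparisonDA_surjective (T : DiffBimod dB N) (n : ℕ) :
    Function.Surjective (comparisonDA (M := M) (N := N) φ n) := by
  have hs : Function.Surjective (shiftMap (comparison (M := M) (N := N) φ.hom) n) := by
    cases n with
    | zero => exact fun _ => ⟨PUnit.unit, rfl⟩
    | succ n => exact comparison_surjective φ.hom T.toBimod n
  rintro ⟨y, z⟩
  obtain ⟨f, rfl⟩ := comparison_surjective φ.hom T.toBimod n y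
  obtain ⟨g, hg⟩ := hs ((-1 : F) ^ n • z)
  refine ⟨(f, g), Prod.ext rfl ?_⟩
  change (-1 : F) ^ n • shiftMap (comparison φ.hom) n g = z
  rw [hg, smul_smul, ← mul_pow, neg_one_mul, neg_neg, one_pow, one_smul]

/-- The kernel is the cone of Φ between two acyclic kernels, one for plain and one for twisted
coefficients. -/
lemma exists_primitive_ker_comparisonDA (n : ℕ) (z : CDA F (MapAlg φ.hom) (M × N × N) n)
    (hz : dDA (mapDiffBimod φ ψ) n z = 0) (h : comparisonDA φ n z = 0) :
    ∃ k, shiftD (dDA (mapDiffBimod φ ψ)) n k = z ∧ shiftMap (comparisonDA φ) n k = 0 := by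
  obtain ⟨f, g⟩ := z
  obtain ⟨k, hk, hk'⟩ := exists_primitive_ker_comparison (isMapBimod_mapBimod φ ψ) n f
    (congrArg Prod.fst hz) (congrArg Prod.fst h)
  cases n with
  | zero =>
    refine ⟨PUnit.unit, Prod.ext hk rfl, rfl⟩
  | succ n =>
    change HC F (MapAlg φ.hom) (M × N × N) n at k g
    change dAlg _ n k = f at hk
    change comparison φ.hom n k = 0 at hk'
    have hg : comparison φ.hom n g = 0 := by
      have h2 : (-1 : F) ^ (n + 1) • comparison φ.hom n g = 0 := congrArg Prod.snd h
      exact (smul_eq_zero.1 h2).resolve_left (pow_ne_zero _ (neg_ne_zero.2 one_ne_zero))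
    have hd : -dAlg (mapDiffBimod φ ψ).tri n g - bigPhi (mapDiffBimod φ ψ) (n + 1) f = 0 :=
      congrArg Prod.snd hz
    -- With f = ∂k, the cocycle condition reads ∂_▷ g = -Φ∂k = -∂_▷Φk, so g + Φk is closed. It lies
    -- in the kernel because g and k do.
    obtain ⟨l, hl, hl'⟩ := exists_primitive_ker_comparison (isMapBimod_tri φ ψ) n
      (g + bigPhi (mapDiffBimod φ ψ) n k)
      (by rw [map_add, ← bigPhi_dAlg, hk, ← neg_eq_zero, neg_add', hd])
      (by rw [map_add, hg, comparison_bigPhi, hk', map_zero, add_zero])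
    refine ⟨(k, -l), Prod.ext hk ?_, Prod.ext hk' ?_⟩
    · change -shiftD (dAlg (mapDiffBimod φ ψ).tri) n (-l) - bigPhi (mapDiffBimod φ ψ) n k = g
      rw [map_neg, hl, neg_neg, add_sub_cancel_right]
    · change (-1 : F) ^ n • shiftMap (comparison φ.hom) n (-l) = 0
      rw [map_neg, hl', neg_zero, smul_zero]

end Comparison

end DiffMor

end

theorem mainTheorem1 {F : Type*} [Field F] [CharZero F] (lam : F)
    {A : Type*} [Ring A] [Algebra F A] {B : Type*} [Ring B] [Algebra F B]
    {M : Type*} [AddCommGroup M] [Module F M] {N : Type*} [AddCommGroup N] [Module F N]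
    (dA : DiffMor.DiffOp F lam A) (dB : DiffMor.DiffOp F lam B)
    (φ : DiffMor.DiffHom dA dB)
    (S : DiffMor.DiffBimod dA M) (T : DiffMor.DiffBimod dB N)
    (ψ : DiffMor.DiffBimodHom S (T.restrict φ)) (n : ℕ) :
    Nonempty (DiffMor.HMor φ ψ n ≃ₗ[F] DiffMor.HDA (DiffMor.mapDiffBimod φ ψ) n) :=
  DiffMor.nonempty_cohomology_equiv DiffMor.dDA_dDA (DiffMor.comparisonDA_dDA φ ψ)
    (DiffMor.comparisonDA_surjective φ T) (DiffMor.exists_primitive_ker_comparisonDA φ ψ) n
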